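/- Let $F$ be a non-Archimedean local field (of any characteristic) with ring of integers $\mathcal O_F$, residue field of cardinality $q$ and residue characteristic $p\neq 2$; let $|\cdot|$ be the normalized absolute value and $|dx|$ the Haar measure on $F$ with $\operatorname{vol}(\mathcal O_F)=1$. Let $f_0$ be the characteristic function of $\mathrm{GL}_2(\mathcal O_F)$. Let $|\omega_G|$ be the Haar measure on $\mathrm{GL}_2(F)$ for which $\mathrm{GL}_2(\mathcal O_F)$ has volume $1$; it is a constant times $|\det g|^{-2}\prod|dg_{ij}|$. Let $\mathfrak c(g)=(a,s)=(\operatorname{tr} g,\det g)$ be the Steinberg map, and let its base $\{(a,s):s\neq0\}$ carry the centre-invariant measure $|\omega_{\mathbb A}|=|s|^{-1/2}\,|da|\,|ds|/|s|$. For a regular semisimple $\gamma$ (distinct eigenvalues), the geometric measure on the fibre $\mathfrak c^{-1}(\mathfrak c(\gamma))$, which is the conjugacy class of $\gamma$, is the quotient measure $|\omega_{\mathfrak c(\gamma)}|$ defined by $\omega_G=\omega_{\mathfrak c(\gamma)}\wedge\mathfrak c^*\omega_{\mathbb A}$: if $u$ consists of two of the matrix entries, $v$ of the other two, and $J=\partial(\operatorname{tr},\det)/\partial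 v\neq 0$, it is $|J|^{-1}|du|$ times the density of $|\omega_G|$ (with respect to $\prod |dg_{ij}|$) divided by the density of $|\omega_{\mathbb A}|$ (with respect to $|da||ds|$). This measure exists and is unique. Let $O^{\rm geom}_\gamma(f_0)$ be the integral of $f_0$ over the conjugacy class of $\gamma$ with respect to it. Let $D(\gamma)=(1-\lambda_1/\lambda_2)(1-\lambda_2/\lambda_1)$ be the Weyl discriminant, where $\lambda_1,\lambda_2$ are the eigenvalues of $\gamma$. Call $\gamma$ hyperbolic if its eigenvalues lie in $F$, and otherwise elliptic: unramified or ramified according to whether $F(\lambda_1)/F$ is. (1) Let $\gamma\in \mathrm{GL}_2(F)$ be regular semisimple and such that its conjugacy class meets $\mathrm{GL}_2(\mathcal O_F)$. If $\gamma$ is elliptic, there is an integer $d_\gamma\ge 0$ with $|D(\gamma)|=q^{-2d_\gamma}$ if $\gamma$ is unramified and $|D(\gamma)|=q^{-2d_\gamma-1}$ if $\gamma$ is ramified. Moreover $$O^{\rm geom}_\gamma(f_0)=\Bigl(1-\frac1q\Bigr)^{-2}\cdot\begin{cases}1&\gamma\text{ hyperbolic},\\ 1-\frac{2}{q+1}\,q^{-d_\gamma}&\gamma\text{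 unramified elliptic},\\ 1-q^{-(d_\gamma+1)}&\gamma\text{ ramified elliptic}.\end{cases}$$ (2) There is a continuous function $\Phi$ on the base $F=\mathbb A^1(F)$ of the Steinberg map $g\mapsto \operatorname{tr} g$ of $\mathrm{SL}_2$ such that $O^{\rm geom}_\gamma(f_0)=\Phi(\operatorname{tr}\gamma)$ for all regular semisimple $\gamma\in \mathrm{SL}_2(F)$ (that is, for $\operatorname{tr}\gamma\neq\pm2$), and $\Phi(2)=\Phi(-2)=(1-1/q)^{-2}$. -/

import Mathlib

open MeasureTheory ValuativeRel

noncomputable section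

namespace GeomOrbital

instance instMeasurableSpaceGL (F : Type*) [Field F] [TopologicalSpace F] :
    MeasurableSpace (GL (Fin 2) F) := borel _

instance instBorelSpaceGL (F : Type*) [Field F] [TopologicalSpace F] :
    BorelSpace (GL (Fin 2) F) := ⟨rfl⟩

section LocalField

variable (F : Type*) [Field F] [ValuativeRel F] [TopologicalSpace F]
  [IsNonarchimedeanLocalField F]

/-- The cardinality `q` of the residue field. -/
def resCard : ℕ := Nat.card 𝓀[F]

/-- The normalized valuation of `x ≠ 0`, with `ord ϖ = 1` for a uniformizer `ϖ`
(the order isomorphism of the value group with `ℤ` is unique). -/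
def ord (x : F) : ℤ :=
  -WithZero.log (IsNonarchimedeanLocalField.valueGroupWithZeroIsoInt F (valuation F x))

open Classical in
/-- The normalized absolute value `|x| = q ^ (-ord x)`, `|0| = 0`. -/
def nabs (x : F) : ℝ := if x = 0 then 0 else (resCard F : ℝ) ^ (-ord F x)

/-- The maximal compact subgroup `GL₂(𝒪_F)` of `GL₂(F)`. -/
def maxCompact : Subgroup (GL (Fin 2) F) :=
  (Matrix.GeneralLinearGroup.map (n := Fin 2) (algebraMap 𝒪[F] F)).range

/-- The characteristic function `f₀` of `GL₂(𝒪_F)`. -/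
def f₀ : GL (Fin 2) F → ℝ := Set.indicator (maxCompact F : Set (GL (Fin 2) F)) 1

variable [MeasurableSpace F] [BorelSpace F]

/-- The additive Haar measure `|dx|` on `F` which gives the ring of integers volume `1`. -/
def haarF : Measure F :=
  ((Measure.addHaar : Measure F) (𝒪[F] : Set F))⁻¹ • Measure.addHaar

/-- The volume of `GL₂(𝒪_F)` for the measure `∏ |dx_ij| / |det x| ^ 2` on `GL₂(F)`
(on this subgroup the determinant has absolute value `1`). -/
def volMaxCompact : ℝ :=
  (Measure.pi (fun _ : Fin 2 × Fin 2 => haarF F)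
    ((fun (g : GL (Fin 2) F) (k : Fin 2 × Fin 2) => g.val k.1 k.2) ''
      (maxCompact F : Set (GL (Fin 2) F)))).toReal

/-- The density, with respect to `∏ |dx_ij|` and at a point of determinant `s`, of the Haar
measure `|ω_G|` on `GL₂(F)` that gives `GL₂(𝒪_F)` volume `1`. -/
def groupDensity (s : F) : ℝ := (volMaxCompact F)⁻¹ * (nabs F s ^ 2)⁻¹

/-- The density, with respect to `|da| |ds|` and at the point `(a, s)`, of the measure `|ω_A|` on
the Steinberg-Hitchin base of `GL₂`, whose points are the pairs `(a, s)`, `s ≠ 0`, of a trace and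
a determinant. The measure is `|s| ^ (-1/2) |da| |ds| / |s|`. It is invariant under the action
`(a, s) ↦ (z a, z ^ 2 s)` of the centre: if `g = z g'` with `det g' = 1`, it is the product of the
measure `|da'|`, `a' = tr g'`, on the base of `SL₂` and the invariant measure on the centre. -/
def baseDensity (s : F) : ℝ := (nabs F s) ^ (-(1 / 2) : ℝ) * (nabs F s)⁻¹

end LocalField

section Geometric

variable {F : Type*} [Field F]

/-- The Steinberg map `g ↦ (tr g, det g)`. -/
def steinberg (g : GL (Fin 2) F) : F × F := (g.val.trace, g.val.det)

/-- The partial derivatives at `g` of the two coordinates (trace and determinant) of the Steinberg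
map with respect to the matrix entry `k`. -/
def steinbergDeriv (g : GL (Fin 2) F) (k : Fin 2 × Fin 2) : Fin 2 → F :=
  ![if k.1 = k.2 then 1 else 0, g.val.adjugate k.2 k.1]

/-- An enumeration `e` of the four matrix entries singles out the first two entries
`u = (x_{e 0}, x_{e 1})`, which are used as coordinates on the fibres of the Steinberg map. -/
def chartCoord (e : Fin 4 ≃ Fin 2 × Fin 2) (g : GL (Fin 2) F) : Fin 2 → F :=
  ![g.val (e 0).1 (e 0).2, g.val (e 1).1 (e 1).2]

/-- The Jacobian determinant `∂(tr, det) / ∂(x_{e 2}, x_{e 3})` with respect to the other two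
entries. The functions `chartCoord e` are local coordinates on a fibre where it is nonzero. -/
def chartJac (e : Fin 4 ≃ Fin 2 × Fin 2) (g : GL (Fin 2) F) : F :=
  (Matrix.of ![steinbergDeriv g (e 2), steinbergDeriv g (e 3)]).det

/-- Regular semisimple: the eigenvalues in an algebraic closure are distinct. -/
def IsRegularSemisimple (g : GL (Fin 2) F) : Prop := g.val.charpoly.Separable

/-- Hyperbolic, or split: both eigenvalues lie in `F`. -/
def IsHyperbolic (g : GL (Fin 2) F) : Prop := g.val.charpoly.Splits

/-- Elliptic: the eigenvalues do not lie in `F`. -/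
def IsElliptic (g : GL (Fin 2) F) : Prop := ¬ IsHyperbolic g

/-- The Weyl discriminant `D(g) = (1 - l₁ / l₂) (1 - l₂ / l₁) = -(l₁ - l₂) ^ 2 / det g`, where
`l₁`, `l₂` are the eigenvalues of `g`. -/
def weylDisc (g : GL (Fin 2) F) : F := -(g.val.trace ^ 2 - 4 * g.val.det) / g.val.det

variable [ValuativeRel F]

/-- The field generated over `F` by the eigenvalues of `g` is unramified over `F`: a uniformizer
of `F` generates the maximal ideal of its ring of integers. -/
def IsUnramified (g : GL (Fin 2) F) : Prop :=
  (Ideal.map (algebraMap 𝒪[F] (integralClosure 𝒪[F] g.val.charpoly.SplittingField))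
    𝓂[F]).IsMaximal

variable [TopologicalSpace F] [IsNonarchimedeanLocalField F] [MeasurableSpace F] [BorelSpace F]

/-- `μ` is the geometric measure `|ω_c|` on the fibre of the Steinberg map `st` over `c = (a, s)`,
where the form `ω_c` on the fibre is defined by `ω_G = ω_c ∧ st^* ω_A`.
In the coordinates `u = chartCoord e` this equation gives, with `J = chartJac e`,
`|ω_c| = (groupDensity s / baseDensity s) |J|⁻¹ |du|` where `J ≠ 0`; so in any such chart
`baseDensity s * |J| |ω_c| = groupDensity s * |du|`. -/
structure IsGeometricMeasure (c : F × F) (μ : Measure (GL (Fin 2) F)) : Prop where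
  supported : μ (steinberg ⁻¹' {c})ᶜ = 0
  chart : ∀ (e : Fin 4 ≃ Fin 2 × Fin 2) (B : Set (GL (Fin 2) F)), MeasurableSet B →
    B ⊆ steinberg ⁻¹' {c} → (∀ g ∈ B, chartJac e g ≠ 0) → Set.InjOn (chartCoord e) B →
    ENNReal.ofReal (baseDensity F c.2) * ∫⁻ g in B, ENNReal.ofReal (nabs F (chartJac e g)) ∂μ =
      ENNReal.ofReal (groupDensity F c.2) *
        Measure.pi (fun _ : Fin 2 => haarF F) (chartCoord e '' B)

open Classical in
/-- The geometric measure on the fibre over `c`. (It exists and is unique over the image `c` of a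
regular semisimple element; the value `0` is a default for other `c`.) -/
def geometricMeasure (c : F × F) : Measure (GL (Fin 2) F) :=
  if h : ∃ μ : Measure (GL (Fin 2) F), IsGeometricMeasure c μ then h.choose else 0

/-- The orbital integral of `f` over the conjugacy class of `g` in `GL₂(F)`, with respect to the
geometric measure. -/
def orbitalIntegral (g : GL (Fin 2) F) (f : GL (Fin 2) F → ℝ) : ℝ :=
  ∫ x in conjugatesOf g, f x ∂(geometricMeasure (steinberg g))

end Geometric

end GeomOrbital

end

/-!
Let `g` be regular semisimple, with trace `a` and determinant `s`. A point of the fibre of the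
Steinberg map over `(a, s)` with `x₁₀ ≠ 0` is determined by its first column, which gives
coordinates on the complement of a null set of the fibre. The Jacobian determinant of this chart is
`x₁₀`, so `fibreMeasure a s = |x₁₀|⁻¹ |dx₀₀| |dx₁₀|` is the only candidate for the geometric
measure, up to the constant given by the densities. That it is given by `|J|⁻¹` in every other
chart as well (`lintegral_chartJac_fibreMeasure`) is a change of variables: the transition maps
are, in one variable with the other one fixed, `z ↦ h / z` or a quadratic polynomial. In a small
ball about each point where its derivative is nonzero, such a map multiplies distances by a
constant, and (by Hensel's lemma in the quadratic case) the image of the ball is a ball; so the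
Haar measure is multiplied by the same constant (`haarF_image_eq_lintegral`). Uniqueness follows
once the locus `x₁₀ = 0` is known to be null; it is covered by the charts `(x₀₀, x₀₁)` and `(x₁₀,
x₀₁)`, in which one coordinate takes only finitely many values (`IsGeometricMeasure.compl_null`).

The fibre is the conjugacy class of `g` (`conjugatesOf_eq_fibre`). If `a` is integral and `s` is a
unit, the point with first column `(x, z)` lies in `GL₂(𝒪)` if and only if `x` and `z` are integral
and `z` divides `x (a - x) - s`. Cutting the integral according to the valuation `n` of `z`, and
completing the square, gives `orbitalIntegral_eq_tsum`: with `δ = a ^ 2 / 4 - s`, the orbital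
integral is `(1 - q ^ (-2))⁻¹` times the sum over `n` of the volumes of the sets `{t ∈ 𝒪 : t ^ 2 ≡
δ mod 𝔪 ^ n}`. Let `m` be the valuation of `δ`, which is that of the Weyl discriminant. For `n ≤ m`
the condition is `t ^ 2 ≡ 0`. For `n > m` the set consists of two balls if `δ` is a square and is
empty otherwise, by Hensel's lemma. Summing geometric series gives the three values
(`tsum_sqrtVol_sq`, `tsum_sqrtVol_of_not_isSquare`), once it is known that adjoining the square
root of a nonsquare `δ` gives an unramified extension exactly when `m` is even
(`isMaximal_of_even`, `not_isMaximal_of_odd`).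

The terms of the series are locally constant in `δ` and bounded by those of a convergent series
that does not depend on `δ`. So the series is continuous in `δ`, also at `δ = 0`, where `a = ±2` on
`SL₂`; its value there is the same as for nonzero squares.
-/

noncomputable section

namespace GeomOrbital

/-! ### The normalized absolute value -/

section AbsoluteValue

variable {F : Type*} [Field F] [ValuativeRel F] [TopologicalSpace F]
  [IsNonarchimedeanLocalField F]

variable (F) in
lemma one_lt_resCard : (1 : ℝ) < resCard F := by
  have : 1 < Nat.card 𝓀[F] := Finite.one_lt_card
  exact_mod_cast this

variable (F) in
lemma resCard_pos : (0 : ℝ) < resCard F := zero_lt_one.trans (one_lt_resCard F)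

@[simp] lemma nabs_zero : nabs F 0 = 0 := by simp [nabs]

lemma nabs_of_ne_zero {x : F} (hx : x ≠ 0) : nabs F x = (resCard F : ℝ) ^ (-ord F x) := by
  simp [nabs, hx]

lemma nabs_pos {x : F} (hx : x ≠ 0) : 0 < nabs F x := by
  rw [nabs_of_ne_zero hx]
  exact zpow_pos (resCard_pos F) _

lemma nabs_nonneg (x : F) : 0 ≤ nabs F x := by
  by_cases hx : x = 0
  · simp [hx]
  · exact (nabs_pos hx).le

@[simp] lemma nabs_eq_zero {x : F} : nabs F x = 0 ↔ x = 0 :=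
  ⟨fun h => by_contra fun hx => (nabs_pos hx).ne' h, fun h => by simp [h]⟩

lemma ord_mul {x y : F} (hx : x ≠ 0) (hy : y ≠ 0) : ord F (x * y) = ord F x + ord F y := by
  simp only [ord, map_mul]
  rw [WithZero.log_mul (by simpa using hx) (by simpa using hy)]
  ring

lemma nabs_mul (x y : F) : nabs F (x * y) = nabs F x * nabs F y := by
  by_cases hx : x = 0
  · simp [hx]
  by_cases hy : y = 0
  · simp [hy]
  rw [nabs_of_ne_zero hx, nabs_of_ne_zero hy, nabs_of_ne_zero (mul_ne_zero hx hy),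
    ord_mul hx hy, neg_add, zpow_add₀ (resCard_pos F).ne']

lemma nabs_le_nabs {x y : F} : nabs F x ≤ nabs F y ↔ valuation F x ≤ valuation F y := by
  by_cases hx : x = 0
  · simp [hx, nabs_nonneg]
  by_cases hy : y = 0
  · simp only [hy, nabs_zero, map_zero, le_zero_iff, map_eq_zero, hx, iff_false, not_le]
    exact nabs_pos hx
  rw [nabs_of_ne_zero hx, nabs_of_ne_zero hy, zpow_le_zpow_iff_right₀ (one_lt_resCard F),
    ord, ord, neg_neg, neg_neg, WithZero.log_le_log (by simpa using hx) (by simpa using hy),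
    map_le_map_iff]

lemma nabs_lt_nabs {x y : F} : nabs F x < nabs F y ↔ valuation F x < valuation F y := by
  rw [← not_le, nabs_le_nabs, not_le]

@[simp] lemma nabs_one : nabs F 1 = 1 := by
  have h := nabs_mul (1 : F) 1
  have h0 := nabs_pos (one_ne_zero (α := F))
  rw [mul_one] at h
  nlinarith

lemma nabs_add_le (x y : F) : nabs F (x + y) ≤ max (nabs F x) (nabs F y) := by
  rcases le_total (nabs F x) (nabs F y) with h | h
  · rw [max_eq_right h, nabs_le_nabs]
    exact (valuation F).map_add_le (nabs_le_nabs.1 h) le_rfl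
  · rw [max_eq_left h, nabs_le_nabs]
    exact (valuation F).map_add_le le_rfl (nabs_le_nabs.1 h)

@[simp] lemma nabs_neg (x : F) : nabs F (-x) = nabs F x :=
  le_antisymm (nabs_le_nabs.2 (by rw [Valuation.map_neg]))
    (nabs_le_nabs.2 (by rw [Valuation.map_neg]))

lemma nabs_sub_comm (x y : F) : nabs F (x - y) = nabs F (y - x) := by
  rw [← nabs_neg, neg_sub]

lemma nabs_sub_le (x y : F) : nabs F (x - y) ≤ max (nabs F x) (nabs F y) := by
  simpa [sub_eq_add_neg] using nabs_add_le x (-y)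

lemma nabs_sub_le_max (x y z : F) : nabs F (x - z) ≤ max (nabs F (x - y)) (nabs F (y - z)) := by
  simpa using nabs_add_le (x - y) (y - z)

lemma nabs_inv (x : F) : nabs F x⁻¹ = (nabs F x)⁻¹ := by
  by_cases hx : x = 0
  · simp [hx]
  · exact eq_inv_of_mul_eq_one_left (by rw [← nabs_mul, inv_mul_cancel₀ hx, nabs_one])

lemma nabs_div (x y : F) : nabs F (x / y) = nabs F x / nabs F y := by
  rw [div_eq_mul_inv, nabs_mul, nabs_inv, div_eq_mul_inv]

lemma nabs_pow (x : F) (n : ℕ) : nabs F (x ^ n) = nabs F x ^ n := by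
  induction n with
  | zero => simp
  | succ n ih => rw [pow_succ, nabs_mul, ih, pow_succ]

/-- A sum with a strictly dominant term has the absolute value of that term. -/
lemma nabs_add_eq_left {x y : F} (h : nabs F y < nabs F x) : nabs F (x + y) = nabs F x := by
  refine le_antisymm ((nabs_add_le x y).trans (max_le le_rfl h.le)) ?_
  have h' := nabs_sub_le (x + y) y
  rw [add_sub_cancel_right] at h'
  rcases le_max_iff.1 h' with h' | h'
  · exact h'
  · exact absurd h' (not_le.2 h)

lemma mem_integer_iff {x : F} : x ∈ 𝒪[F] ↔ nabs F x ≤ 1 := by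
  rw [Valuation.mem_integer_iff, ← nabs_one (F := F), nabs_le_nabs, map_one]

lemma isUnit_integer_iff {x : 𝒪[F]} : IsUnit x ↔ nabs F (x : F) = 1 := by
  rw [(Valuation.integer.integers (valuation F)).isUnit_iff_valuation_eq_one]
  have h1 := nabs_le_nabs (x := (x : F)) (y := 1)
  have h2 := nabs_le_nabs (x := 1) (y := (x : F))
  rw [nabs_one, map_one] at h1 h2
  rw [le_antisymm_iff, le_antisymm_iff, h1, h2]
  rfl

lemma mem_maximalIdeal_iff {x : 𝒪[F]} : x ∈ 𝓂[F] ↔ nabs F (x : F) < 1 := by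
  rw [IsLocalRing.mem_maximalIdeal, mem_nonunits_iff, isUnit_integer_iff,
    (mem_integer_iff.1 x.2).lt_iff_ne]

variable (F) in
lemma exists_uniformizer : ∃ ϖ : F, ord F ϖ = 1 ∧ nabs F ϖ = (resCard F : ℝ)⁻¹ := by
  obtain ⟨x, hx⟩ := ValuativeRel.valuation_surjective (K := F)
    ((IsNonarchimedeanLocalField.valueGroupWithZeroIsoInt F).symm (WithZero.exp (-1 : ℤ)))
  have ho : ord F x = 1 := by simp [ord, hx]
  refine ⟨x, ho, ?_⟩
  have hx0 : x ≠ 0 := by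
    rintro rfl
    simp [ord] at ho
  rw [nabs_of_ne_zero hx0, ho, zpow_neg_one]

variable (F) in
/-- A uniformizer of the local field `F`. -/
def unif : F := (exists_uniformizer F).choose

lemma nabs_unif : nabs F (unif F) = (resCard F : ℝ)⁻¹ := (exists_uniformizer F).choose_spec.2

lemma unif_ne_zero : unif F ≠ 0 := by
  rw [Ne, ← nabs_eq_zero, nabs_unif]
  exact inv_ne_zero (resCard_pos F).ne'

lemma nabs_unif_pow (n : ℕ) : nabs F (unif F ^ n) = ((resCard F : ℝ) ^ n)⁻¹ := by
  rw [nabs_pow, nabs_unif, inv_pow]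

/-- The absolute value is discrete: below `q ^ (-n)` the next possible value is
`q ^ (-(n + 1))`. -/
lemma nabs_lt_zpow_iff {x : F} {n : ℤ} :
    nabs F x < (resCard F : ℝ) ^ n ↔ nabs F x ≤ (resCard F : ℝ) ^ (n - 1) := by
  by_cases hx : x = 0
  · simp [hx, zpow_pos (resCard_pos F), (zpow_pos (resCard_pos F) _).le]
  · rw [nabs_of_ne_zero hx, zpow_lt_zpow_iff_right₀ (one_lt_resCard F),
      zpow_le_zpow_iff_right₀ (one_lt_resCard F)]
    omega

variable (F) in
lemma nabs_two (hp : ringChar 𝓀[F] ≠ 2) : nabs F 2 = 1 := by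
  have h2 : (2 : 𝓀[F]) ≠ 0 := Ring.two_ne_zero hp
  have : IsUnit (2 : 𝒪[F]) := by
    by_contra h
    apply h2
    have := (IsLocalRing.residue_eq_zero_iff (2 : 𝒪[F])).2 ((IsLocalRing.mem_maximalIdeal _).2 h)
    rwa [map_ofNat] at this
  exact isUnit_integer_iff.1 this

lemma two_ne_zero_of_ringChar (hp : ringChar 𝓀[F] ≠ 2) : (2 : F) ≠ 0 := by
  rw [Ne, ← nabs_eq_zero, nabs_two F hp]
  exact one_ne_zero

/-! ### The topology of the absolute value -/

lemma hasBasis_nhds_nabs (x : F) :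
    (nhds x).HasBasis (fun r : ℝ => 0 < r) (fun r => {y | nabs F (y - x) < r}) := by
  refine (IsValuativeTopology.hasBasis_nhds' x).to_hasBasis ?_ ?_
  · intro γ hγ
    obtain ⟨c, rfl⟩ := ValuativeRel.valuation_surjective γ
    exact ⟨nabs F c, nabs_pos (by simpa using hγ), fun y hy => nabs_lt_nabs.1 hy⟩
  · intro r hr
    obtain ⟨n, hn⟩ := exists_pow_lt_of_lt_one hr (inv_lt_one_of_one_lt₀ (one_lt_resCard F))
    refine ⟨valuation F (unif F ^ n), by simp [unif_ne_zero], fun y hy => ?_⟩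
    have := nabs_lt_nabs.2 hy
    rw [nabs_unif_pow, ← inv_pow] at this
    exact this.trans hn

variable (F) in
/-- The metric `|x - y|` of a local field. Its topology is, definitionally, the given one. -/
abbrev nabsMetricSpace : MetricSpace F :=
  MetricSpace.replaceTopology
    { dist := fun x y => nabs F (x - y)
      dist_self := by simp
      dist_comm := nabs_sub_comm
      dist_triangle := fun x y z => (nabs_sub_le_max x y z).trans
        (max_le_add_of_nonneg (nabs_nonneg _) (nabs_nonneg _))
      eq_of_dist_eq_zero := fun {x y} h => sub_eq_zero.1 (nabs_eq_zero.1 h) } (by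
    refine TopologicalSpace.ext_nhds fun x => ?_
    refine (hasBasis_nhds_nabs x).eq_of_same_basis ?_
    exact @Metric.nhds_basis_ball F (_) x)

lemma isOpen_nabs_sub_lt (x : F) (r : ℝ) : IsOpen {y | nabs F (y - x) < r} := by
  let := nabsMetricSpace F
  exact Metric.isOpen_ball (x := x) (ε := r)

lemma isClosed_nabs_sub_le (x : F) (r : ℝ) : IsClosed {y | nabs F (y - x) ≤ r} := by
  let := nabsMetricSpace F
  exact Metric.isClosed_closedBall (x := x) (ε := r)

instance : T2Space F := by
  let := nabsMetricSpace F
  infer_instance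

@[fun_prop] lemma continuous_nabs : Continuous (nabs F) := by
  let := nabsMetricSpace F
  have : nabs F = fun x => dist x 0 := by
    funext x
    change nabs F x = nabs F (x - 0)
    rw [sub_zero]
  rw [this]
  fun_prop

lemma isCompact_nabs_le (n : ℕ) : IsCompact {x : F | nabs F x ≤ (resCard F : ℝ) ^ n} := by
  convert IsNonarchimedeanLocalField.isCompact_closedBall F (valuation F (unif F ^ n)⁻¹) using 3
  rw [← nabs_le_nabs, nabs_inv, nabs_unif_pow, inv_inv]

instance : SigmaCompactSpace F where
  isSigmaCompact_univ := by
    refine ⟨fun n => {x : F | nabs F x ≤ (resCard F : ℝ) ^ n}, isCompact_nabs_le, ?_⟩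
    refine Set.eq_univ_of_forall fun x => Set.mem_iUnion.2 ?_
    obtain ⟨n, hn⟩ := pow_unbounded_of_one_lt (nabs F x) (one_lt_resCard F)
    exact ⟨n, hn.le⟩

instance : SecondCountableTopology F := by
  let := nabsMetricSpace F
  infer_instance

instance : TopologicalSpace.MetrizableSpace F := by
  let := nabsMetricSpace F
  infer_instance

instance : PolishSpace F := by
  let := IsTopologicalAddGroup.rightUniformSpace F
  have := isUniformAddGroup_of_addCommGroup (G := F)
  have : (uniformity F).IsCountablyGenerated :=
    IsUniformAddGroup.uniformity_countably_generated
  infer_instance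

/-- Hensel's lemma for square roots in odd residue characteristic. -/
lemma exists_sq_eq_one_add (hp : ringChar 𝓀[F] ≠ 2) {m : F} (hm : nabs F m < 1) :
    ∃ n : F, (1 + n) ^ 2 = 1 + m ∧ nabs F n < 1 := by
  let m' : 𝒪[F] := ⟨m, mem_integer_iff.2 hm.le⟩
  have hm' : m' ∈ 𝓂[F] := mem_maximalIdeal_iff.2 hm
  have : HenselianRing 𝒪[F] 𝓂[F] := by
    let := IsTopologicalAddGroup.rightUniformSpace F
    have := isUniformAddGroup_of_addCommGroup (G := F)
    infer_instance
  have h2 : IsUnit (2 : 𝒪[F]) := isUnit_integer_iff.2 (nabs_two F hp)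
  obtain ⟨r, hr, hr1⟩ := HenselianRing.is_henselian (I := 𝓂[F])
    (Polynomial.X ^ 2 - Polynomial.C (1 + m')) (Polynomial.monic_X_pow_sub_C _ two_ne_zero) 1
    (by simpa using hm') (by simpa [one_add_one_eq_two] using h2.map (Ideal.Quotient.mk 𝓂[F]))
  refine ⟨((r - 1 : 𝒪[F]) : F), ?_, mem_maximalIdeal_iff.1 hr1⟩
  have hr' : r ^ 2 = 1 + m' := by simpa [Polynomial.IsRoot, sub_eq_zero] using hr
  have := congrArg (Subtype.val : 𝒪[F] → F) hr'
  push_cast at this ⊢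
  rw [add_sub_cancel, this]

end AbsoluteValue

/-! ### The normalized Haar measure -/

section Haar

variable {F : Type*} [Field F] [ValuativeRel F] [TopologicalSpace F]
  [IsNonarchimedeanLocalField F]

/-- A representative in `𝒪[F]` of a residue class. -/
def residueLift (k : 𝓀[F]) : 𝒪[F] := Function.surjInv IsLocalRing.residue_surjective k

lemma residue_residueLift (k : 𝓀[F]) : IsLocalRing.residue 𝒪[F] (residueLift k) = k :=
  Function.surjInv_eq IsLocalRing.residue_surjective k

lemma residue_eq_iff {x : 𝒪[F]} {k : 𝓀[F]} :
    IsLocalRing.residue 𝒪[F] x = k ↔ nabs F ((x : F) - (residueLift k : F)) < 1 := by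
  have := mem_maximalIdeal_iff (x := x - residueLift k)
  rw [← IsLocalRing.residue_eq_zero_iff, map_sub, residue_residueLift, sub_eq_zero] at this
  simpa using this

lemma mem_integer_of_nabs_sub_lt {x y : F} (hy : y ∈ 𝒪[F]) (h : nabs F (x - y) < 1) :
    x ∈ 𝒪[F] := by
  have := add_mem (mem_integer_iff.2 h.le) hy
  rwa [sub_add_cancel] at this

variable (F) in
/-- The ring of integers is the union of the residue classes of the maximal ideal. -/
lemma integer_eq_iUnion_residue :
    (𝒪[F] : Set F) = ⋃ k : 𝓀[F], {x | nabs F (x - (residueLift k : F)) < 1} := by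
  ext x
  simp only [SetLike.mem_coe, Set.mem_iUnion, Set.mem_ofPred_eq]
  constructor
  · intro hx
    exact ⟨IsLocalRing.residue 𝒪[F] ⟨x, hx⟩, residue_eq_iff (x := ⟨x, hx⟩).1 rfl⟩
  · rintro ⟨k, hk⟩
    exact mem_integer_of_nabs_sub_lt (residueLift k).2 hk

lemma pairwise_disjoint_residue : Pairwise (Function.onFun Disjoint
    fun k : 𝓀[F] => {x | nabs F (x - (residueLift k : F)) < 1}) := by
  intro k l hkl
  refine Set.disjoint_left.2 fun x hk hl => hkl ?_
  have hx := mem_integer_of_nabs_sub_lt (residueLift k).2 hk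
  exact (residue_eq_iff (x := ⟨x, hx⟩).2 hk).symm.trans (residue_eq_iff (x := ⟨x, hx⟩).2 hl)

lemma coe_integer_eq : (𝒪[F] : Set F) = {x | nabs F x ≤ 1} :=
  Set.ext fun _ => mem_integer_iff

lemma image_mul_closed_ball {c : F} (hc : c ≠ 0) (r : ℝ) :
    (fun x => c * x) '' {x | nabs F x ≤ r} = {x | nabs F x ≤ nabs F c * r} := by
  ext y
  constructor
  · rintro ⟨x, hx, rfl⟩
    simp only [Set.mem_ofPred_eq, nabs_mul] at hx ⊢
    exact mul_le_mul_of_nonneg_left hx (nabs_nonneg c)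
  · intro hy
    refine ⟨c⁻¹ * y, ?_, mul_inv_cancel_left₀ hc y⟩
    rw [Set.mem_ofPred_eq, nabs_mul, nabs_inv, inv_mul_le_iff₀ (nabs_pos hc)]
    exact hy

lemma image_mul_open_ball {c : F} (hc : c ≠ 0) (r : ℝ) :
    (fun x => c * x) '' {x | nabs F x < r} = {x | nabs F x < nabs F c * r} := by
  ext y
  constructor
  · rintro ⟨x, hx, rfl⟩
    simp only [Set.mem_ofPred_eq, nabs_mul] at hx ⊢
    exact mul_lt_mul_of_pos_left hx (nabs_pos hc)
  · intro hy
    refine ⟨c⁻¹ * y, ?_, mul_inv_cancel_left₀ hc y⟩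
    rw [Set.mem_ofPred_eq, nabs_mul, nabs_inv, inv_mul_lt_iff₀ (nabs_pos hc)]
    exact hy

lemma ball_inter_ball {t t' z : F} {r r' : ℝ} (hz : nabs F (z - t) < r)
    (hz' : nabs F (z - t') < r') :
    {x | nabs F (x - t) < r} ∩ {x | nabs F (x - t') < r'} =
      {x | nabs F (x - z) < min r r'} := by
  have recenter {t : F} {r : ℝ} (hz : nabs F (z - t) < r) (x : F) :
      nabs F (x - t) < r ↔ nabs F (x - z) < r := by
    constructor <;> intro h
    · exact (nabs_sub_le_max x t z).trans_lt (max_lt h (by rwa [nabs_sub_comm]))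
    · exact (nabs_sub_le_max x z t).trans_lt (max_lt h hz)
  ext x
  simp only [Set.mem_inter_iff, Set.mem_ofPred_eq, recenter hz, recenter hz', lt_min_iff]

variable (F) in
/-- Two open balls are nested or disjoint, so the open balls form a π-system. -/
lemma isPiSystem_balls : IsPiSystem {B : Set F | ∃ t r, B = {x | nabs F (x - t) < r}} := by
  rintro _ ⟨t, r, rfl⟩ _ ⟨t', r', rfl⟩ ⟨z, hz, hz'⟩
  exact ⟨z, min r r', ball_inter_ball hz hz'⟩

variable [MeasurableSpace F] [BorelSpace F]

lemma measurable_nabs : Measurable (nabs F) := continuous_nabs.measurable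

variable (F) in
lemma addHaar_integer_ne_zero : (Measure.addHaar : Measure F) (𝒪[F] : Set F) ≠ 0 := by
  have h : {y : F | nabs F (y - 0) < 1} ⊆ (𝒪[F] : Set F) := by
    intro x hx
    simp only [sub_zero, Set.mem_ofPred_eq] at hx
    exact mem_integer_iff.2 hx.le
  refine fun h0 => ((isOpen_nabs_sub_lt (0 : F) 1).measure_pos Measure.addHaar
    ⟨0, by simp⟩).ne' (measure_mono_null h h0)

variable (F) in
lemma addHaar_integer_ne_top : (Measure.addHaar : Measure F) (𝒪[F] : Set F) ≠ ⊤ := by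
  have := isCompact_nabs_le (F := F) 0
  rw [pow_zero, ← coe_integer_eq] at this
  exact this.measure_lt_top.ne

instance : (haarF F).IsAddHaarMeasure :=
  Measure.IsAddHaarMeasure.smul _ (ENNReal.inv_ne_zero.2 (addHaar_integer_ne_top F))
    (ENNReal.inv_ne_top.2 (addHaar_integer_ne_zero F))

instance : (haarF F).Regular :=
  Measure.Regular.smul (ENNReal.inv_ne_top.2 (addHaar_integer_ne_zero F))

instance : SigmaFinite (haarF F) := inferInstance

@[simp] lemma haarF_integer : haarF F (𝒪[F] : Set F) = 1 := by
  rw [haarF, Measure.smul_apply, smul_eq_mul,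
    ENNReal.inv_mul_cancel (addHaar_integer_ne_zero F) (addHaar_integer_ne_top F)]

lemma haarF_add_left (a : F) (S : Set F) : haarF F ((fun x => a + x) ⁻¹' S) = haarF F S :=
  measure_preimage_add _ a S

lemma haarF_open_ball (a : F) (r : ℝ) :
    haarF F {x | nabs F (x - a) < r} = haarF F {x | nabs F x < r} := by
  rw [← haarF_add_left (-a) {x | nabs F x < r}]
  congr 1
  ext x
  simp [sub_eq_neg_add]

lemma haarF_closed_ball (a : F) (r : ℝ) :
    haarF F {x | nabs F (x - a) ≤ r} = haarF F {x | nabs F x ≤ r} := by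
  rw [← haarF_add_left (-a) {x | nabs F x ≤ r}]
  congr 1
  ext x
  simp [sub_eq_neg_add]

variable (F) in
lemma haarF_maximalIdeal : haarF F {x : F | nabs F x < 1} = (resCard F : ENNReal)⁻¹ := by
  have h := haarF_integer (F := F)
  rw [integer_eq_iUnion_residue, measure_iUnion pairwise_disjoint_residue
    fun k => (isOpen_nabs_sub_lt _ _).measurableSet] at h
  simp only [haarF_open_ball] at h
  have := Fintype.ofFinite 𝓀[F]
  rw [tsum_fintype, Finset.sum_const, Finset.card_univ, ← Nat.card_eq_fintype_card,
    nsmul_eq_mul] at h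
  exact ENNReal.eq_inv_of_mul_eq_one_left (by rw [mul_comm]; exact h)

/-- The Haar measure scales by the normalized absolute value. -/
lemma haarF_image_mul {c : F} (hc : c ≠ 0) (S : Set F) :
    haarF F ((fun x => c * x) '' S) = ENNReal.ofReal (nabs F c) * haarF F S := by
  have key (u : Fˣ) (S : Set F) :
      haarF F ((fun x => (u : F) * x) '' S) = distribHaarChar F u * haarF F S := by
    rw [distribHaarChar_mul]
    rfl
  have key1 (u : Fˣ) : haarF F {x : F | nabs F x ≤ nabs F (u : F)} = distribHaarChar F u := by
    have := key u (𝒪[F] : Set F)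
    rwa [haarF_integer, mul_one, coe_integer_eq, image_mul_closed_ball u.ne_zero, mul_one] at this
  -- on units the modulus is `1`, and for a uniformizer it is `q⁻¹`
  have hunit (u : Fˣ) (hu : nabs F (u : F) = 1) : distribHaarChar F u = 1 := by
    have := key1 u
    rw [hu, ← coe_integer_eq, haarF_integer] at this
    exact_mod_cast this.symm
  have hunif : distribHaarChar F (Units.mk0 (unif F) unif_ne_zero) = (resCard F : NNReal)⁻¹ := by
    have := key1 (Units.mk0 (unif F) unif_ne_zero)
    have h2 : {x : F | nabs F x ≤ nabs F (Units.mk0 (unif F) unif_ne_zero : F)} =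
        {x : F | nabs F x < 1} := by
      ext x
      have h3 := nabs_lt_zpow_iff (x := x) (n := 0)
      simp only [zpow_zero, zero_sub, zpow_neg_one] at h3
      simp [h3, nabs_unif]
    rw [h2, haarF_maximalIdeal] at this
    rw [← ENNReal.coe_inj, ← this, ENNReal.coe_inv (by exact_mod_cast (resCard_pos F).ne')]
    simp
  have hall (u : Fˣ) : (distribHaarChar F u : ENNReal) = ENNReal.ofReal (nabs F (u : F)) := by
    set n := ord F (u : F) with hn
    set v : Fˣ := u * (Units.mk0 (unif F) unif_ne_zero) ^ (-n) with hv
    have hϖ (m : ℤ) : nabs F ((unif F) ^ m) = (resCard F : ℝ) ^ (-m) := by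
      cases m with
      | ofNat m => simp [nabs_unif_pow]
      | negSucc m =>
        rw [zpow_negSucc, nabs_inv, nabs_unif_pow, inv_inv, Int.neg_negSucc]
        norm_cast
    have hv1 : nabs F (v : F) = 1 := by
      rw [hv, Units.val_mul, nabs_mul, Units.val_zpow_eq_zpow_val, Units.val_mk0, hϖ,
        nabs_of_ne_zero u.ne_zero, ← zpow_add₀ (resCard_pos F).ne', ← hn]
      simp
    have hu : u = v * (Units.mk0 (unif F) unif_ne_zero) ^ n := by
      rw [hv, mul_assoc, ← zpow_add, neg_add_cancel, zpow_zero, mul_one]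
    have hd : distribHaarChar F u = ((resCard F : NNReal)⁻¹) ^ n := by
      rw [hu, map_mul, hunit v hv1, one_mul, map_zpow, hunif]
    rw [nabs_of_ne_zero u.ne_zero, hd, ← hn, ENNReal.ofReal, ENNReal.coe_inj]
    ext
    rw [Real.coe_toNNReal _ (zpow_pos (resCard_pos F) _).le]
    push_cast
    rw [inv_zpow, zpow_neg]
  have := key (Units.mk0 c hc) S
  rwa [hall] at this

instance : NullSingletonClass (haarF F) where
  -- multiplication by a uniformizer fixes `{0}` and scales the measure by `q⁻¹`
  measure_singleton x := by
    have h0 : haarF F ({0} : Set F) = 0 := by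
      have h := haarF_image_mul unif_ne_zero ({0} : Set F)
      rw [Set.image_singleton, mul_zero] at h
      have hfin : haarF F ({0} : Set F) ≠ ⊤ := isCompact_singleton.measure_lt_top.ne
      by_contra hne
      have h1 : ENNReal.ofReal (nabs F (unif F)) = 1 :=
        (ENNReal.mul_eq_right hne hfin).1 h.symm
      rw [ENNReal.ofReal_eq_one, nabs_unif, inv_eq_one] at h1
      exact (one_lt_resCard F).ne' h1
    rw [← haarF_add_left x]
    convert h0 using 2
    ext y
    simp

lemma haarF_nabs_le (c : F) : haarF F {x | nabs F x ≤ nabs F c} = ENNReal.ofReal (nabs F c) := by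
  by_cases hc : c = 0
  · have : {x : F | nabs F x ≤ nabs F c} = {0} := by
      ext x
      simp [hc, (nabs_nonneg x).ge_iff_eq']
    rw [this, hc, measure_singleton]
    simp
  · have := haarF_image_mul hc (𝒪[F] : Set F)
    rwa [coe_integer_eq, image_mul_closed_ball hc, ← coe_integer_eq, haarF_integer, mul_one,
      mul_one] at this

lemma haarF_nabs_lt_ne_top (r : ℝ) : haarF F {x | nabs F x < r} ≠ ⊤ := by
  obtain ⟨n, hn⟩ := pow_unbounded_of_one_lt r (one_lt_resCard F)
  exact measure_ne_top_of_subset (fun x (hx : nabs F x < r) => (hx.trans hn).le)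
    (isCompact_nabs_le n).measure_lt_top.ne

end Haar

/-! ### Change of variables -/

section ChangeOfVariables

variable {F : Type*} [Field F] [ValuativeRel F] [TopologicalSpace F]
  [IsNonarchimedeanLocalField F]

/-- The map `f` multiplies all distances in the open ball of radius `r` about `t` by `|k|`, and
maps this ball onto the ball of radius `|k| r` about `f t`. For a function with derivative
`k ≠ 0` at `t` this is the form that strict differentiability takes in a sufficiently small
ball. -/
def IsScalingOn (f : F → F) (k t : F) (r : ℝ) : Prop :=
  (∀ x y, nabs F (x - t) < r → nabs F (y - t) < r →
    nabs F (f x - f y) = nabs F k * nabs F (x - y)) ∧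
  ∀ y, nabs F (y - f t) < nabs F k * r → ∃ x, nabs F (x - t) < r ∧ f x = y

lemma IsScalingOn.continuousOn {f : F → F} {k t : F} {r : ℝ} (hf : IsScalingOn f k t r) :
    ContinuousOn f {x | nabs F (x - t) < r} := by
  intro x hx
  refine ((hasBasis_nhds_nabs x).inf_principal _).tendsto_iff (hasBasis_nhds_nabs (f x)) |>.2
    fun ε hε => ⟨ε / (nabs F k + 1), div_pos hε (by have := nabs_nonneg k; linarith), ?_⟩
  intro y hy
  have h1 : nabs F (y - x) < ε / (nabs F k + 1) := hy.1
  have h0 := nabs_nonneg k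
  rw [lt_div_iff₀ (by linarith)] at h1
  have h2 := nabs_nonneg (y - x)
  rw [Set.mem_ofPred_eq, hf.1 y x hy.2 hx]
  nlinarith

variable [MeasurableSpace F] [BorelSpace F]

variable (F) in
lemma borel_eq_generateFrom_balls :
    ‹MeasurableSpace F› =
      MeasurableSpace.generateFrom {B : Set F | ∃ t r, B = {x | nabs F (x - t) < r}} := by
  rw [BorelSpace.measurable_eq (α := F)]
  refine TopologicalSpace.IsTopologicalBasis.borel_eq_generateFrom
    (TopologicalSpace.isTopologicalBasis_of_isOpen_of_nhds ?_ ?_)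
  · rintro _ ⟨t, r, rfl⟩
    exact isOpen_nabs_sub_lt t r
  · intro a u ha hu
    obtain ⟨r, hr, hru⟩ := (hasBasis_nhds_nabs a).mem_iff.1 (hu.mem_nhds ha)
    exact ⟨_, ⟨a, r, rfl⟩, by simpa using hr, hru⟩

/-- In a ball where `f` scales distances by `|k|`, it scales the Haar measure by `|k|`: both sides
are finite measures in `S`, and they agree on the π-system of balls. -/
lemma haarF_image_of_isScalingOn {f : F → F} {k t : F} {r : ℝ} (hk : k ≠ 0) (hr : 0 < r)
    (hf : IsScalingOn f k t r) {S : Set F} (hS : MeasurableSet S)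
    (hSB : S ⊆ {x | nabs F (x - t) < r}) :
    haarF F (f '' S) = ENNReal.ofReal (nabs F k) * haarF F S := by
  set B : Set F := {x | nabs F (x - t) < r} with hB
  set B' : Set F := {y | nabs F (y - f t) < nabs F k * r} with hB'
  have htB : t ∈ B := by simpa [hB] using hr
  have hBm : MeasurableSet B := (isOpen_nabs_sub_lt _ _).measurableSet
  have hB'm : MeasurableSet B' := (isOpen_nabs_sub_lt _ _).measurableSet
  have hinj : Set.InjOn f B := by
    intro x hx y hy hxy
    have := hf.1 x y hx hy
    rw [hxy, sub_self, nabs_zero, eq_comm, mul_eq_zero, nabs_eq_zero, nabs_eq_zero] at this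
    exact sub_eq_zero.1 (this.resolve_left hk)
  have hmaps : Set.MapsTo f B B' := by
    intro x hx
    rw [hB', Set.mem_ofPred_eq, hf.1 x t hx htB]
    exact mul_lt_mul_of_pos_left hx (nabs_pos hk)
  set g := Function.invFunOn f B with hg
  have hgl : Set.LeftInvOn g f B := hinj.leftInvOn_invFunOn
  have hsurj : Set.SurjOn f B B' := fun y hy => hf.2 y hy
  have hgr : Set.RightInvOn g f B' := hsurj.rightInvOn_invFunOn
  have hgm : Set.MapsTo g B' B := hsurj.mapsTo_invFunOn
  have hgc : ContinuousOn g B' := by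
    intro y hy
    have hgb : (nhds (g y)).HasBasis (fun r : ℝ => 0 < r) _ := hasBasis_nhds_nabs (g y)
    refine ((hasBasis_nhds_nabs y).inf_principal B').tendsto_iff hgb |>.2 fun ε hε => ?_
    refine ⟨nabs F k * ε, mul_pos (nabs_pos hk) hε, fun z hz => ?_⟩
    have := hf.1 (g z) (g y) (hgm hz.2) (hgm hy)
    rw [hgr hz.2, hgr hy] at this
    have h2 : nabs F (z - y) < nabs F k * ε := hz.1
    rw [this] at h2
    exact lt_of_mul_lt_mul_left h2 (nabs_nonneg k)
  have hga : AEMeasurable g ((haarF F).restrict B') := hgc.aemeasurable hB'm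
  have himage (S : Set F) : g ⁻¹' S ∩ B' = f '' (S ∩ B) := by
    ext y
    constructor
    · rintro ⟨h1, h2⟩
      exact ⟨g y, ⟨h1, hgm h2⟩, hgr h2⟩
    · rintro ⟨x, ⟨h1, h2⟩, rfl⟩
      exact ⟨by rwa [Set.mem_preimage, hgl h2], hmaps h2⟩
  have hmap {S : Set F} (hS : MeasurableSet S) :
      ((haarF F).restrict B').map g S = haarF F (f '' (S ∩ B)) := by
    rw [Measure.map_apply_of_aemeasurable hga hS, Measure.restrict_apply' hB'm, himage]
  -- on a ball inside `B` both sides are given by the scaling of the Haar measure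
  have hball (t₁ : F) (ht₁ : t₁ ∈ B) (ρ : ℝ) (hρ : ρ ≤ r) :
      haarF F (f '' {x | nabs F (x - t₁) < ρ}) =
        ENNReal.ofReal (nabs F k) * haarF F {x | nabs F (x - t₁) < ρ} := by
    have hsub {x : F} (hx : nabs F (x - t₁) < ρ) : x ∈ B :=
      (nabs_sub_le_max x t₁ t).trans_lt (max_lt (hx.trans_le hρ) ht₁)
    have : f '' {x | nabs F (x - t₁) < ρ} = {y | nabs F (y - f t₁) < nabs F k * ρ} := by
      ext y
      constructor
      · rintro ⟨x, hx, rfl⟩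
        rw [Set.mem_ofPred_eq, hf.1 x t₁ (hsub hx) ht₁]
        exact mul_lt_mul_of_pos_left hx (nabs_pos hk)
      · intro hy
        have hyB : y ∈ B' := (nabs_sub_le_max y (f t₁) (f t)).trans_lt
          (max_lt (lt_of_lt_of_le hy (mul_le_mul_of_nonneg_left hρ (nabs_nonneg k)))
            (hmaps ht₁))
        refine ⟨g y, ?_, hgr hyB⟩
        have := hf.1 (g y) t₁ (hgm hyB) ht₁
        rw [hgr hyB] at this
        rw [Set.mem_ofPred_eq, this] at hy
        exact lt_of_mul_lt_mul_left hy (nabs_nonneg k)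
    rw [this, haarF_open_ball, haarF_open_ball, ← image_mul_open_ball hk, haarF_image_mul hk]
  have hBfin : (haarF F) B' ≠ ⊤ := by
    rw [hB', haarF_open_ball]
    exact haarF_nabs_lt_ne_top _
  have hfull : haarF F (f '' B) = ENNReal.ofReal (nabs F k) * haarF F B := hball t htB r le_rfl
  have hmeas : ((haarF F).restrict B').map g =
      ENNReal.ofReal (nabs F k) • (haarF F).restrict B := by
    have : IsFiniteMeasure (((haarF F).restrict B').map g) := by
      have : IsFiniteMeasure ((haarF F).restrict B') := ⟨by simpa using hBfin.lt_top⟩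
      infer_instance
    refine ext_of_generate_finite _ (borel_eq_generateFrom_balls F) (isPiSystem_balls F) ?_ ?_
    · rintro _ ⟨t', ρ, rfl⟩
      rw [hmap (isOpen_nabs_sub_lt _ _).measurableSet, Measure.smul_apply, smul_eq_mul,
        Measure.restrict_apply' hBm]
      rcases Set.eq_empty_or_nonempty ({x | nabs F (x - t') < ρ} ∩ B) with h | ⟨z, hz, hzB⟩
      · simp [h]
      · rw [ball_inter_ball hz hzB, hball z hzB _ (min_le_right _ _)]
    · rw [hmap MeasurableSet.univ, Set.univ_inter, hfull]
      simp
  have := congrArg (fun μ => μ S) hmeas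
  simpa [hmap hS, Set.inter_eq_left.2 hSB, Measure.restrict_apply' hBm] using this

/-- The change of variables formula on the line, for a function that scales distances by `|k t|` in
a ball about each point `t`. The set `S` is cut into countably many pieces lying in such balls. -/
lemma haarF_image_eq_lintegral {f k : F → F} {U : Set F}
    (hf : ∀ t ∈ U, k t ≠ 0 ∧ ∃ r > 0, IsScalingOn f (k t) t r ∧
      ∀ x, nabs F (x - t) < r → nabs F (k x) = nabs F (k t))
    {S : Set F} (hS : MeasurableSet S) (hSU : S ⊆ U) (hinj : Set.InjOn f S) :
    haarF F (f '' S) = ∫⁻ x in S, ENNReal.ofReal (nabs F (k x)) ∂haarF F := by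
  choose! hk r hr hsc hconst using hf
  obtain ⟨T, hTS, hTc, hT⟩ := TopologicalSpace.countable_cover_nhdsWithin (s := S)
    (f := fun t => {x | nabs F (x - t) < r t}) fun t ht => mem_nhdsWithin_of_mem_nhds
      ((isOpen_nabs_sub_lt t (r t)).mem_nhds (by simpa using hr t (hSU ht)))
  rcases T.eq_empty_or_nonempty with rfl | hTn
  · have : S = ∅ := by simpa using hT
    simp [this]
  obtain ⟨c, hc⟩ := hTc.exists_eq_range hTn
  have hcU (n : ℕ) : c n ∈ U := hSU (hTS (hc ▸ Set.mem_range_self n))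
  set A : ℕ → Set F := disjointed fun n => S ∩ {x | nabs F (x - c n) < r (c n)} with hA
  have hAm (n : ℕ) : MeasurableSet (A n) := MeasurableSet.disjointed
    (fun n => hS.inter (isOpen_nabs_sub_lt _ _).measurableSet) n
  have hAsub (n : ℕ) : A n ⊆ S ∩ {x | nabs F (x - c n) < r (c n)} := disjointed_subset _ _
  have hAd : Pairwise (Function.onFun Disjoint A) := disjoint_disjointed _
  have hAU : S = ⋃ n, A n := by
    rw [hA, iUnion_disjointed, ← Set.inter_iUnion, eq_comm, Set.inter_eq_left]
    rw [hc, Set.biUnion_range] at hT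
    exact hT
  have hloc (n : ℕ) : haarF F (f '' A n) = ∫⁻ x in A n, ENNReal.ofReal (nabs F (k x)) ∂haarF F := by
    rw [haarF_image_of_isScalingOn (hk _ (hcU n)) (hr _ (hcU n)) (hsc _ (hcU n)) (hAm n)
      fun x hx => (hAsub n hx).2, setLIntegral_congr_fun (hAm n)
      (g := fun _ => ENNReal.ofReal (nabs F (k (c n))))
      fun x hx => by rw [hconst _ (hcU n) x (hAsub n hx).2]]
    simp
  have hAinj (n : ℕ) : Set.InjOn f (A n) := hinj.mono fun x hx => (hAsub n hx).1
  have hcont (n : ℕ) : ContinuousOn f (A n) :=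
    (hsc _ (hcU n)).continuousOn.mono fun x hx => (hAsub n hx).2
  conv_lhs => rw [hAU]
  rw [Set.image_iUnion, measure_iUnion]
  · simp_rw [hloc]
    conv_rhs => rw [hAU]
    rw [lintegral_iUnion hAm hAd]
  · intro m n hmn
    refine Set.disjoint_left.2 ?_
    rintro _ ⟨x, hx, rfl⟩ ⟨y, hy, hxy⟩
    have := hinj (hAsub m hx).1 (hAsub n hy).1 hxy.symm
    subst this
    exact Set.disjoint_left.1 (hAd hmn) hx hy
  · intro n
    exact (hAm n).image_of_continuousOn_injOn (hcont n) (hAinj n)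

/-- Change of variables for `z ↦ h / z`; the ball about `t` used here has radius `|t|`. -/
lemma haarF_image_div_eq_lintegral {h : F} (hh : h ≠ 0) {S : Set F} (hS : MeasurableSet S)
    (hS0 : ∀ z ∈ S, z ≠ 0) :
    haarF F ((fun z => h / z) '' S) = ∫⁻ z in S, ENNReal.ofReal (nabs F (h / z ^ 2)) ∂haarF F := by
  refine haarF_image_eq_lintegral (U := {z | z ≠ 0}) (fun t (ht : t ≠ 0) => ?_) hS hS0 ?_
  · have hnear {x : F} (hx : nabs F (x - t) < nabs F t) : nabs F x = nabs F t := by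
      simpa using nabs_add_eq_left hx
    have hne {x : F} (hx : nabs F (x - t) < nabs F t) : x ≠ 0 := by
      rw [Ne, ← nabs_eq_zero, hnear hx, nabs_eq_zero]
      exact ht
    refine ⟨div_ne_zero hh (pow_ne_zero 2 ht), nabs F t, nabs_pos ht, ⟨fun x y hx hy => ?_,
      fun y hy => ?_⟩, fun x hx => ?_⟩
    · have : h / x - h / y = h / (x * y) * (y - x) := by
        field_simp [hne hx, hne hy]
      rw [this, nabs_mul, nabs_div, nabs_div, nabs_mul, nabs_pow, hnear hx, hnear hy,
        nabs_sub_comm y x, pow_two]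
    · have hy' : nabs F (y - h / t) < nabs F (h / t) := by
        refine hy.trans_eq ?_
        rw [nabs_div, nabs_div, nabs_pow]
        field_simp [(nabs_pos ht).ne']
      have hyn : nabs F y = nabs F (h / t) := by simpa using nabs_add_eq_left hy'
      have hy0 : y ≠ 0 := by
        rw [Ne, ← nabs_eq_zero, hyn, nabs_eq_zero]
        exact div_ne_zero hh ht
      refine ⟨h / y, ?_, div_div_cancel₀ hh⟩
      have : h / y - t = -(t * (y - h / t) / y) := by
        field_simp
        ring
      rw [this, nabs_neg, nabs_div, nabs_mul, hyn, div_lt_iff₀ (nabs_pos (div_ne_zero hh ht))]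
      exact mul_lt_mul_of_pos_left hy' (nabs_pos ht)
    · rw [nabs_div, nabs_div, nabs_pow, nabs_pow, hnear hx]
  · intro x hx y hy hxy
    simpa [div_eq_mul_inv, hh] using hxy

/-- Change of variables for the quadratic polynomial `x (a - x) - s`, up to a scalar. The ball
about `t` on which it is injective has radius `|a - 2 t|`, and Hensel's lemma shows that the image
of this ball is a ball. -/
lemma haarF_image_quadratic_eq_lintegral (hp : ringChar 𝓀[F] ≠ 2) (a s : F) {z : F} (hz : z ≠ 0)
    {S : Set F} (hS : MeasurableSet S) (hSa : ∀ x ∈ S, a - 2 * x ≠ 0)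
    (hinj : Set.InjOn (fun x => (x * (a - x) - s) / z) S) :
    haarF F ((fun x => (x * (a - x) - s) / z) '' S) =
      ∫⁻ x in S, ENNReal.ofReal (nabs F ((a - 2 * x) / z)) ∂haarF F := by
  have h2 := two_ne_zero_of_ringChar hp
  have h21 := nabs_two F hp
  refine haarF_image_eq_lintegral (U := {x | a - 2 * x ≠ 0})
    (fun t (ht : a - 2 * t ≠ 0) => ?_) hS hSa hinj
  refine ⟨div_ne_zero ht hz, nabs F (a - 2 * t), nabs_pos ht, ⟨fun x y hx hy => ?_,
    fun y hy => ?_⟩, fun x hx => ?_⟩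
  · have e : (x * (a - x) - s) / z - (y * (a - y) - s) / z =
        ((a - 2 * t) + (-((x - t) + (y - t)))) / z * (x - y) := by
      field_simp
      ring
    have hlt : nabs F (-((x - t) + (y - t))) < nabs F (a - 2 * t) := by
      rw [nabs_neg]
      exact (nabs_add_le _ _).trans_lt (max_lt hx hy)
    rw [e, nabs_mul, nabs_div, nabs_add_eq_left hlt, nabs_div]
  · set b := a - 2 * t with hb
    set e := y - (t * (a - t) - s) / z with he
    have hm : nabs F (-(4 * (e * z / b ^ 2))) < 1 := by
      have h4 : (4 : F) = 2 * 2 := by norm_num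
      rw [nabs_neg, nabs_mul, h4, nabs_mul, h21, nabs_div, nabs_mul, nabs_pow, one_mul, one_mul,
        div_lt_one (pow_pos (nabs_pos ht) 2), ← lt_div_iff₀ (nabs_pos hz)]
      refine hy.trans_eq ?_
      rw [nabs_div]
      ring
    obtain ⟨n, hn, hn1⟩ := exists_sq_eq_one_add hp hm
    refine ⟨t - b * (n / 2), ?_, ?_⟩
    · have : t - b * (n / 2) - t = -(b * (n / 2)) := by ring
      rw [this, nabs_neg, nabs_mul, nabs_div, h21, div_one]
      exact mul_lt_of_lt_one_right (nabs_pos ht) hn1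
    · have hab : a = b + 2 * t := by rw [hb]; ring
      have hyy : y = (t * (a - t) - s) / z + e := by rw [he]; ring
      have hn' : n ^ 2 + 2 * n = -(4 * (e * z / b ^ 2)) := by linear_combination hn
      have hn'' : b ^ 2 * (n ^ 2 + 2 * n) = -4 * (e * z) := by
        rw [hn']
        field_simp
      rw [hyy, div_add' _ _ _ hz, div_left_inj' hz]
      apply mul_left_cancel₀ (mul_ne_zero h2 h2)
      field_simp
      rw [hab]
      linear_combination (-1) * hn''
  · have e : (a - 2 * x) = (a - 2 * t) + -(2 * (x - t)) := by ring
    rw [e, nabs_div, nabs_add_eq_left, nabs_div]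
    rwa [nabs_neg, nabs_mul, h21, one_mul]

/-- A fibrewise change of variables in the plane. -/
lemma prod_image_eq_lintegral {f k : F → F → F} {S : Set (F × F)} (hS : MeasurableSet S)
    (hf : ContinuousOn (fun p : F × F => f p.1 p.2) S)
    (hinj : Set.InjOn (fun p : F × F => (p.1, f p.1 p.2)) S)
    (hk : Measurable fun p : F × F => k p.1 p.2)
    (h : ∀ x, haarF F (f x '' (Prod.mk x ⁻¹' S)) =
      ∫⁻ z in Prod.mk x ⁻¹' S, ENNReal.ofReal (nabs F (k x z)) ∂haarF F) :
    (haarF F).prod (haarF F) ((fun p : F × F => (p.1, f p.1 p.2)) '' S) =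
      ∫⁻ p in S, ENNReal.ofReal (nabs F (k p.1 p.2)) ∂(haarF F).prod (haarF F) := by
  have hT : MeasurableSet ((fun p : F × F => (p.1, f p.1 p.2)) '' S) :=
    hS.image_of_continuousOn_injOn (continuous_fst.continuousOn.prodMk hf) hinj
  have hm : Measurable fun p : F × F => ENNReal.ofReal (nabs F (k p.1 p.2)) :=
    (measurable_nabs.comp hk).ennreal_ofReal
  rw [Measure.prod_apply hT, ← lintegral_indicator hS,
    lintegral_prod _ (hm.indicator hS).aemeasurable]
  refine lintegral_congr fun x => ?_
  have e1 : Prod.mk x ⁻¹' ((fun p : F × F => (p.1, f p.1 p.2)) '' S) =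
      f x '' (Prod.mk x ⁻¹' S) := by
    ext y
    constructor
    · rintro ⟨⟨x', z⟩, hp, he⟩
      obtain ⟨rfl, rfl⟩ := Prod.mk.inj he
      exact ⟨z, hp, rfl⟩
    · rintro ⟨z, hz, rfl⟩
      exact ⟨(x, z), hz, rfl⟩
  rw [e1, h, ← lintegral_indicator (measurable_prodMk_left hS)]
  rfl

end ChangeOfVariables

/-! ### The fibres of the Steinberg map -/

section Fibre

section Algebra

variable {F : Type*} [Field F]

lemma mem_steinberg_fibre {g : GL (Fin 2) F} {a s : F} :
    g ∈ steinberg ⁻¹' {(a, s)} ↔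
      g.val 1 1 = a - g.val 0 0 ∧
        g.val 0 1 * g.val 1 0 = g.val 0 0 * (a - g.val 0 0) - s := by
  simp only [steinberg, Set.mem_preimage, Set.mem_singleton_iff, Prod.mk.injEq,
    Matrix.trace_fin_two, Matrix.det_fin_two]
  constructor
  · rintro ⟨h1, h2⟩
    have h3 : g.val 1 1 = a - g.val 0 0 := by rw [← h1]; ring
    exact ⟨h3, by rw [← h3, ← h2]; ring⟩
  · rintro ⟨h1, h2⟩
    exact ⟨by rw [h1]; ring, by rw [h2, h1]; ring⟩

open Classical in
/-- The point of the fibre of the Steinberg map over `(a, s)` whose first column is `p`, where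
`p.2 ≠ 0`. (The value is `1` if `s = 0` or `p.2 = 0`.) -/
def fibrePoint (a s : F) (p : F × F) : GL (Fin 2) F :=
  if h : s ≠ 0 ∧ p.2 ≠ 0 then
    { val := !![p.1, (p.1 * (a - p.1) - s) / p.2; p.2, a - p.1]
      inv := !![(a - p.1) / s, -((p.1 * (a - p.1) - s) / p.2) / s; -p.2 / s, p.1 / s]
      val_inv := by
        obtain ⟨hs, hz⟩ := h
        ext i j
        fin_cases i <;> fin_cases j <;> simp [Matrix.mul_apply] <;> field_simp <;> ring
      inv_val := by
        obtain ⟨hs, hz⟩ := h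
        ext i j
        fin_cases i <;> fin_cases j <;> simp [Matrix.mul_apply] <;> field_simp <;> ring }
  else 1

variable {a s : F} {p : F × F}

lemma fibrePoint_val (hs : s ≠ 0) (hp : p.2 ≠ 0) :
    (fibrePoint a s p).val = !![p.1, (p.1 * (a - p.1) - s) / p.2; p.2, a - p.1] := by
  rw [fibrePoint, dif_pos ⟨hs, hp⟩]

lemma fibrePoint_mem (hs : s ≠ 0) (hp : p.2 ≠ 0) :
    fibrePoint a s p ∈ steinberg ⁻¹' {(a, s)} := by
  rw [mem_steinberg_fibre, fibrePoint_val hs hp]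
  simp [hp]

lemma fibrePoint_column (hs : s ≠ 0) {g : GL (Fin 2) F} (hg : g ∈ steinberg ⁻¹' {(a, s)})
    (hz : g.val 1 0 ≠ 0) : fibrePoint a s (g.val 0 0, g.val 1 0) = g := by
  rw [mem_steinberg_fibre] at hg
  ext i j
  rw [fibrePoint_val hs hz]
  fin_cases i <;> fin_cases j <;> simp [← hg.2, hg.1, hz]

/-- The part of a subset of the fibre where `x₁₀ ≠ 0`, in the coordinates given by the first
column. -/
lemma image_fibrePoint {a s : F} (hs : s ≠ 0) {B : Set (GL (Fin 2) F)}
    (hB : B ⊆ steinberg ⁻¹' {(a, s)}) :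
    fibrePoint a s '' (fibrePoint a s ⁻¹' B ∩ {p | p.2 ≠ 0}) = B ∩ {g | g.val 1 0 ≠ 0} := by
  ext g
  constructor
  · rintro ⟨p, ⟨hpB, hp⟩, rfl⟩
    refine ⟨hpB, ?_⟩
    rw [Set.mem_ofPred_eq, fibrePoint_val hs hp]
    simpa using hp
  · rintro ⟨hgB, hg⟩
    have := fibrePoint_column hs (hB hgB) hg
    exact ⟨(g.val 0 0, g.val 1 0), ⟨by rwa [Set.mem_preimage, this], hg⟩, this⟩

/-- On the fibre over `(a, s)` the discriminant `a ^ 2 - 4 s` is `(x₀₀ - x₁₁) ^ 2 + 4 x₀₁ x₁₀`. -/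
lemma disc_of_mem_fibre {g : GL (Fin 2) F} (hg : g ∈ steinberg ⁻¹' {(a, s)}) :
    (g.val 0 0 - g.val 1 1) ^ 2 + 4 * (g.val 0 1 * g.val 1 0) = a ^ 2 - 4 * s := by
  rw [mem_steinberg_fibre] at hg
  rw [hg.1, hg.2]
  ring

lemma finite_roots (a s : F) : {x : F | x * (a - x) - s = 0}.Finite := by
  rcases Set.eq_empty_or_nonempty {x : F | x * (a - x) - s = 0} with h | ⟨r, hr⟩
  · simp [h]
  · refine (Set.toFinite {r, a - r}).subset fun x hx => ?_
    have hr' : r * (a - r) - s = 0 := hr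
    have hx' : x * (a - x) - s = 0 := hx
    have : (x - r) * (x - (a - r)) = 0 := by linear_combination hr' - hx'
    simpa [sub_eq_zero] using this

lemma steinberg_ne_zero (g : GL (Fin 2) F) : (steinberg g).2 ≠ 0 :=
  g.isUnit.map Matrix.detMonoidHom |>.ne_zero

/-- Regular semisimple means that the discriminant of the characteristic polynomial is nonzero. -/
lemma disc_ne_zero_of_isRegularSemisimple (h2 : (2 : F) ≠ 0) {g : GL (Fin 2) F}
    (hg : IsRegularSemisimple g) :
    g.val.trace ^ 2 - 4 * g.val.det ≠ 0 := by
  intro h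
  obtain ⟨u, v, huv⟩ := hg
  rw [Matrix.charpoly_fin_two] at huv
  set a := g.val.trace
  set s := g.val.det
  simp only [Polynomial.derivative_add, Polynomial.derivative_sub, Polynomial.derivative_X_pow,
    Polynomial.derivative_C, Polynomial.derivative_C_mul, Polynomial.derivative_X] at huv
  have h1 := congrArg (Polynomial.eval (a / 2)) huv
  have e : (a / 2) ^ 2 - a * (a / 2) + s = 0 := by
    field_simp
    linear_combination -h
  have e2 : 2 * (a / 2) - a = 0 := by field_simp; simp
  simp [e, e2] at h1

end Algebra

@[fun_prop] lemma continuous_entry {F : Type*} [Field F] [TopologicalSpace F]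
    (i j : Fin 2) : Continuous fun g : GL (Fin 2) F => g.val i j :=
  (Units.continuous_val (M := Matrix (Fin 2) (Fin 2) F)).matrix_elem i j

variable {F : Type*} [Field F] [ValuativeRel F] [TopologicalSpace F]
  [IsNonarchimedeanLocalField F]

lemma continuousOn_fibrePoint (a s : F) : ContinuousOn (fibrePoint a s) {p | p.2 ≠ 0} := by
  by_cases hs : s = 0
  · refine (continuousOn_const (c := 1)).congr fun p _ => ?_
    rw [fibrePoint, dif_neg (by simp [hs])]
  rw [continuousOn_iff_continuous_domRestrict, Units.continuous_iff]
  have hz (p : {p : F × F | p.2 ≠ 0}) : p.1.2 ≠ 0 := p.2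
  have hval (p : {p : F × F | p.2 ≠ 0}) :=
    fibrePoint_val (F := F) (a := a) (p := p.1) hs p.2
  have hinv (p : {p : F × F | p.2 ≠ 0}) : (↑(fibrePoint a s p.1)⁻¹ : Matrix (Fin 2) (Fin 2) F) =
      !![(a - p.1.1) / s, -((p.1.1 * (a - p.1.1) - s) / p.1.2) / s; -p.1.2 / s, p.1.1 / s] := by
    rw [fibrePoint, dif_pos ⟨hs, p.2⟩]
    rfl
  constructor
  · refine continuous_matrix fun i j => ?_
    simp only [Function.comp_apply, Set.domRestrict_apply, hval]
    fin_cases i <;> fin_cases j <;> simp <;> fun_prop (disch := exact hz)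
  · refine continuous_matrix fun i j => ?_
    simp only [Set.domRestrict_apply, hinv]
    fin_cases i <;> fin_cases j <;> simp <;> fun_prop (disch := assumption)

lemma measurableSet_fibre (c : F × F) : MeasurableSet (steinberg (F := F) ⁻¹' {c}) := by
  obtain ⟨a, s⟩ := c
  have : steinberg (F := F) ⁻¹' {(a, s)} = {g | g.val 1 1 = a - g.val 0 0} ∩
      {g | g.val 0 1 * g.val 1 0 = g.val 0 0 * (a - g.val 0 0) - s} := by
    ext g
    exact mem_steinberg_fibre
  rw [this]
  refine (IsClosed.inter ?_ ?_).measurableSet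
  · exact isClosed_eq (by fun_prop) (by fun_prop)
  · exact isClosed_eq (by fun_prop) (by fun_prop)

@[fun_prop] lemma measurable_entry {F : Type*} [Field F] [TopologicalSpace F] [MeasurableSpace F]
    [BorelSpace F] (i j : Fin 2) :
    Measurable fun g : GL (Fin 2) F => g.val i j := (continuous_entry i j).measurable

variable [MeasurableSpace F] [BorelSpace F]

lemma _root_.Measurable.ofReal_nabs {α : Type*} [MeasurableSpace α] {f : α → F}
    (hf : Measurable f) : Measurable fun x => ENNReal.ofReal (nabs F (f x)) :=
  (measurable_nabs.comp hf).ennreal_ofReal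

lemma measurableSet_snd_ne_zero : MeasurableSet {p : F × F | p.2 ≠ 0} :=
  measurable_snd (measurableSet_singleton 0).compl

lemma measurable_fibrePoint (a s : F) : Measurable (fibrePoint a s) := by
  classical
  have h1 := (continuousOn_fibrePoint a s).measurable_piecewise
    (continuousOn_const (c := (1 : GL (Fin 2) F)) (s := {p : F × F | p.2 ≠ 0}ᶜ))
    measurableSet_snd_ne_zero
  convert! h1 using 1
  ext p : 1
  by_cases hp : p.2 = 0
  · rw [Set.piecewise_eq_of_notMem _ _ _ (by simpa using hp), fibrePoint, dif_neg (by simp [hp])]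
  · rw [Set.piecewise_eq_of_mem _ _ _ (by simpa using hp)]

/-- The invariant measure `|x₁₀|⁻¹ |dx₀₀| |dx₁₀|` on the fibre of the Steinberg map over
`(a, s)`, obtained from the coordinates given by the first column. The points with `x₁₀ = 0` are
a null set. -/
def fibreMeasure (a s : F) : Measure (GL (Fin 2) F) :=
  ((((haarF F).prod (haarF F)).restrict {p | p.2 ≠ 0}).withDensity
    fun p => ENNReal.ofReal (nabs F p.2)⁻¹).map (fibrePoint a s)

lemma setLIntegral_fibreMeasure (a s : F) {B : Set (GL (Fin 2) F)} (hB : MeasurableSet B)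
    {φ : GL (Fin 2) F → ENNReal} (hφ : Measurable φ) :
    ∫⁻ g in B, φ g ∂fibreMeasure a s =
      ∫⁻ p in fibrePoint a s ⁻¹' B ∩ {p | p.2 ≠ 0},
        ENNReal.ofReal (nabs F p.2)⁻¹ * φ (fibrePoint a s p) ∂(haarF F).prod (haarF F) := by
  have h1 := measurable_fibrePoint a s
  rw [fibreMeasure, setLIntegral_map hB hφ h1,
    setLIntegral_withDensity_eq_setLIntegral_mul (g := fun p => φ (fibrePoint a s p)) _ _
      (hφ.comp h1) (h1 hB),
    Measure.restrict_restrict (h1 hB)]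
  · rfl
  · exact (measurable_nabs.comp measurable_snd).inv.ennreal_ofReal

lemma fibreMeasure_compl (a : F) {s : F} (hs : s ≠ 0) :
    fibreMeasure a s (steinberg ⁻¹' {(a, s)})ᶜ = 0 := by
  rw [← setLIntegral_one, setLIntegral_fibreMeasure _ _ (measurableSet_fibre _).compl
    measurable_const]
  have : fibrePoint a s ⁻¹' (steinberg ⁻¹' {(a, s)})ᶜ ∩ {p | p.2 ≠ 0} = ∅ := by
    ext p
    simp only [Set.mem_inter_iff, Set.mem_preimage, Set.mem_compl_iff, Set.mem_ofPred_eq,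
      Set.mem_empty_iff_false, iff_false, not_and, not_not]
    intro h
    by_contra hp
    exact h (fibrePoint_mem hs hp)
  rw [this]
  simp

/-! ### Charts on the fibres -/

lemma measure_image_eq_of_diff_null {α β : Type*} [MeasurableSpace β] (μ : Measure β) (f : α → β)
    {B C : Set α} (h : μ (f '' (B \ C)) = 0) : μ (f '' B) = μ (f '' (B ∩ C)) := by
  refine le_antisymm ?_ (measure_mono (Set.image_mono Set.inter_subset_left))
  rw [← Set.inter_union_sdiff B C, Set.image_union]
  refine (measure_union_le _ _).trans ?_
  rw [h, add_zero]
  exact measure_mono (Set.image_mono (by simp))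

lemma prod_haarF_fst_null {S : Set (F × F)} {R : Set F} (hR : R.Countable)
    (hS : ∀ p ∈ S, p.1 ∈ R) : (haarF F).prod (haarF F) S = 0 := by
  refine measure_mono_null (t := R ×ˢ Set.univ) (fun p hp => ⟨hS p hp, trivial⟩) ?_
  rw [Measure.prod_prod, hR.measure_zero, zero_mul]

section Charts

variable {a s : F} {B : Set (GL (Fin 2) F)}

/-- The measure `fibreMeasure` in the coordinates `(x₀₀, x₁₀)`, by which it is defined. -/
lemma fibreMeasure_chart_column (hs : s ≠ 0) (hBm : MeasurableSet B)
    (hB : B ⊆ steinberg ⁻¹' {(a, s)}) (hB0 : ∀ g ∈ B, g.val 1 0 ≠ 0) :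
    (haarF F).prod (haarF F) ((fun g => (g.val 0 0, g.val 1 0)) '' B) =
      ∫⁻ g in B, ENNReal.ofReal (nabs F (g.val 1 0)) ∂fibreMeasure a s := by
  rw [setLIntegral_fibreMeasure _ _ hBm
    (measurable_entry 1 0).ofReal_nabs]
  set S := fibrePoint a s ⁻¹' B ∩ {p | p.2 ≠ 0} with hS
  have hSm : MeasurableSet S := (measurable_fibrePoint a s hBm).inter measurableSet_snd_ne_zero
  have h1 : (fun g : GL (Fin 2) F => (g.val 0 0, g.val 1 0)) '' B = S := by
    have : fibrePoint a s '' S = B := (image_fibrePoint hs hB).trans (Set.inter_eq_left.2 hB0)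
    rw [← this, Set.image_image]
    refine (Set.image_congr fun p hp => ?_).trans (Set.image_id _)
    rw [fibrePoint_val hs hp.2]
    rfl
  rw [h1, ← setLIntegral_one]
  refine setLIntegral_congr_fun hSm fun p hp => ?_
  have hp0 := nabs_pos hp.2
  rw [fibrePoint_val hs hp.2, ← ENNReal.ofReal_mul (inv_nonneg.2 (nabs_nonneg _))]
  simp [inv_mul_cancel₀ hp0.ne']

/-- The measure `fibreMeasure` in the coordinates `(x₀₀, x₀₁)`: for fixed `x = x₀₀` the change of
coordinates is `x₁₀ ↦ (x (a - x) - s) / x₁₀`. -/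
lemma fibreMeasure_chart_row (hs : s ≠ 0) (hBm : MeasurableSet B)
    (hB : B ⊆ steinberg ⁻¹' {(a, s)}) (hB0 : ∀ g ∈ B, g.val 0 1 ≠ 0) :
    (haarF F).prod (haarF F) ((fun g => (g.val 0 0, g.val 0 1)) '' B) =
      ∫⁻ g in B, ENNReal.ofReal (nabs F (g.val 0 1)) ∂fibreMeasure a s := by
  rw [setLIntegral_fibreMeasure _ _ hBm
    (measurable_entry 0 1).ofReal_nabs]
  set S := fibrePoint a s ⁻¹' B ∩ {p | p.2 ≠ 0} with hS
  have hSm : MeasurableSet S := (measurable_fibrePoint a s hBm).inter measurableSet_snd_ne_zero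
  set f : F → F → F := fun x z => (x * (a - x) - s) / z with hf
  have hSh (p : F × F) (hp : p ∈ S) : p.1 * (a - p.1) - s ≠ 0 := by
    have := hB0 _ hp.1
    rw [fibrePoint_val hs hp.2] at this
    intro h
    simp [h] at this
  -- the points with `x₁₀ = 0` do not contribute, since `x₀₀` is then an eigenvalue
  have h1 : (haarF F).prod (haarF F) ((fun g => (g.val 0 0, g.val 0 1)) '' B) =
      (haarF F).prod (haarF F) ((fun p : F × F => (p.1, f p.1 p.2)) '' S) := by
    have h2 : (fun p : F × F => (p.1, f p.1 p.2)) '' S =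
        (fun g : GL (Fin 2) F => (g.val 0 0, g.val 0 1)) '' (B ∩ {g | g.val 1 0 ≠ 0}) := by
      rw [← image_fibrePoint hs hB, Set.image_image, ← hS]
      refine Set.image_congr fun p hp => ?_
      rw [fibrePoint_val hs hp.2]
      rfl
    rw [h2]
    refine measure_image_eq_of_diff_null _ _ (prod_haarF_fst_null (finite_roots a s).countable ?_)
    rintro _ ⟨g, ⟨hg, hgz⟩, rfl⟩
    have hgz' : g.val 1 0 = 0 := by simpa using hgz
    have := (mem_steinberg_fibre.1 (hB hg)).2
    rw [hgz', mul_zero] at this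
    exact this.symm
  have hS0 : ∀ p ∈ S, p.2 ≠ 0 := fun p hp => hp.2
  rw [h1, prod_image_eq_lintegral (k := fun x z => (x * (a - x) - s) / z ^ 2) hSm]
  · refine setLIntegral_congr_fun hSm fun p hp => ?_
    rw [fibrePoint_val hs hp.2, ← ENNReal.ofReal_mul (inv_nonneg.2 (nabs_nonneg _))]
    simp only [Matrix.of_apply, Matrix.cons_val', Matrix.cons_val_one, Matrix.cons_val_zero,
      Matrix.cons_val_fin_one]
    rw [nabs_div, nabs_div, nabs_pow]
    congr 1
    field_simp
  · fun_prop (disch := exact hS0 _ ‹_›)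
  · rintro ⟨x, z⟩ hp ⟨x', z'⟩ hp' he
    obtain ⟨rfl, he⟩ := Prod.mk.inj he
    have hh := hSh _ hp
    rw [Prod.mk.injEq]
    refine ⟨rfl, ?_⟩
    simpa [hf, div_eq_mul_inv, hh] using he
  · fun_prop
  · intro x
    by_cases hx : x * (a - x) - s = 0
    · have : Prod.mk x ⁻¹' S = ∅ := by
        ext z
        simp only [Set.mem_preimage, Set.mem_empty_iff_false, iff_false]
        exact fun hz => hSh _ hz hx
      simp [this]
    · exact haarF_image_div_eq_lintegral hx (measurable_prodMk_left hSm) fun z hz => hS0 _ hz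

/-- The measure `fibreMeasure` in the coordinates `(x₁₀, x₀₁)`: for fixed `z = x₁₀` the change of
coordinates is `x₀₀ ↦ (x₀₀ (a - x₀₀) - s) / z`. -/
lemma fibreMeasure_chart_antidiagonal (hp : ringChar 𝓀[F] ≠ 2) (hs : s ≠ 0)
    (hBm : MeasurableSet B) (hB : B ⊆ steinberg ⁻¹' {(a, s)})
    (hB0 : ∀ g ∈ B, g.val 1 1 - g.val 0 0 ≠ 0)
    (hinj : Set.InjOn (fun g : GL (Fin 2) F => (g.val 1 0, g.val 0 1)) B) :
    (haarF F).prod (haarF F) ((fun g => (g.val 1 0, g.val 0 1)) '' B) =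
      ∫⁻ g in B, ENNReal.ofReal (nabs F (g.val 1 1 - g.val 0 0)) ∂fibreMeasure a s := by
  have hm : Measurable fun g : GL (Fin 2) F => g.val 1 1 - g.val 0 0 :=
    (measurable_entry 1 1).sub (measurable_entry 0 0)
  rw [setLIntegral_fibreMeasure _ _ hBm hm.ofReal_nabs]
  set S := fibrePoint a s ⁻¹' B ∩ {p | p.2 ≠ 0} with hS
  have hSm : MeasurableSet S := (measurable_fibrePoint a s hBm).inter measurableSet_snd_ne_zero
  set S' : Set (F × F) := Prod.swap ⁻¹' S with hS'
  have hSm' : MeasurableSet S' := measurable_swap hSm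
  have hS0 : ∀ p ∈ S', p.1 ≠ 0 := fun p hp => hp.2
  set f : F → F → F := fun z x => (x * (a - x) - s) / z with hf
  have hSh (p : F × F) (hp : p ∈ S') : a - 2 * p.2 ≠ 0 := by
    have := hB0 _ hp.1
    rw [fibrePoint_val hs hp.2] at this
    convert this using 1
    simp only [Prod.fst_swap, Matrix.of_apply, Matrix.cons_val', Matrix.cons_val_one,
      Matrix.cons_val_zero, Matrix.cons_val_fin_one]
    ring
  have hcomp (p : F × F) (hp : p ∈ S') :
      ((fibrePoint a s p.swap).val 1 0, (fibrePoint a s p.swap).val 0 1) = (p.1, f p.1 p.2) := by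
    rw [fibrePoint_val hs hp.2]
    rfl
  have hinj' : Set.InjOn (fun p : F × F => (p.1, f p.1 p.2)) S' := by
    intro p hp p' hp' he
    have he' : (p.1, f p.1 p.2) = (p'.1, f p'.1 p'.2) := he
    rw [← hcomp p hp, ← hcomp p' hp'] at he'
    have := hinj hp.1 hp'.1 he'
    have hx := congrArg (fun g : GL (Fin 2) F => g.val 0 0) this
    simp only [fibrePoint_val hs hp.2, fibrePoint_val hs hp'.2] at hx
    exact Prod.ext (Prod.mk.inj he).1 hx
  have h1 : (haarF F).prod (haarF F) ((fun g => (g.val 1 0, g.val 0 1)) '' B) =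
      (haarF F).prod (haarF F) ((fun p : F × F => (p.1, f p.1 p.2)) '' S') := by
    have h2 : (fun p : F × F => (p.1, f p.1 p.2)) '' S' =
        (fun g : GL (Fin 2) F => (g.val 1 0, g.val 0 1)) '' (B ∩ {g | g.val 1 0 ≠ 0}) := by
      rw [← image_fibrePoint hs hB, Set.image_image, ← hS]
      ext q
      constructor
      · rintro ⟨p, hp, rfl⟩
        exact ⟨p.swap, hp, hcomp p hp⟩
      · rintro ⟨p, hp, rfl⟩
        have hp' : p.swap ∈ S' := by simpa [hS'] using hp
        exact ⟨p.swap, hp', (hcomp _ hp').symm⟩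
    rw [h2]
    refine measure_image_eq_of_diff_null _ _ (prod_haarF_fst_null (Set.countable_singleton 0) ?_)
    rintro _ ⟨g, ⟨hg, hgz⟩, rfl⟩
    simpa using hgz
  rw [h1, prod_image_eq_lintegral (k := fun z x => (a - 2 * x) / z) hSm' ?_ hinj' ?_ ?_]
  · have h2 : (haarF F).prod (haarF F) = ((haarF F).prod (haarF F)).map Prod.swap :=
      Measure.prod_swap.symm
    conv_rhs => rw [h2]
    rw [setLIntegral_map hSm ?_ measurable_swap]
    · refine setLIntegral_congr_fun hSm' fun p hp => ?_
      rw [fibrePoint_val hs hp.2, ← ENNReal.ofReal_mul (inv_nonneg.2 (nabs_nonneg _))]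
      simp only [Matrix.of_apply, Matrix.cons_val', Matrix.cons_val_one, Matrix.cons_val_zero,
        Matrix.cons_val_fin_one, Prod.fst_swap, Prod.snd_swap]
      rw [nabs_div, div_eq_inv_mul]
      congr 3
      ring
    · exact (measurable_nabs.comp measurable_snd).inv.ennreal_ofReal.mul
        (hm.comp (measurable_fibrePoint a s)).ofReal_nabs
  · fun_prop (disch := exact hS0 _ ‹_›)
  · fun_prop
  · intro z
    by_cases hz : z = 0
    · have : Prod.mk z ⁻¹' S' = ∅ := by
        ext x
        simp only [Set.mem_preimage, Set.mem_empty_iff_false, iff_false]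
        exact fun hx => hS0 _ hx hz
      simp [this]
    · refine haarF_image_quadratic_eq_lintegral hp a s hz (measurable_prodMk_left hSm')
        (fun x hx => hSh _ hx) fun x hx x' hx' he => ?_
      exact (Prod.mk.inj (hinj' (x₁ := (z, x)) (x₂ := (z, x')) hx hx'
        (Prod.ext rfl he))).2

end Charts

end Fibre

/-! ### Existence and uniqueness of the geometric measure -/

section GeometricMeasure

lemma steinbergDeriv_eq {F : Type*} [Field F] (g : GL (Fin 2) F) :
    steinbergDeriv g (0, 0) = ![1, g.val 1 1] ∧ steinbergDeriv g (1, 1) = ![1, g.val 0 0] ∧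
    steinbergDeriv g (0, 1) = ![0, -g.val 1 0] ∧ steinbergDeriv g (1, 0) = ![0, -g.val 0 1] := by
  simp [steinbergDeriv, Matrix.adjugate_fin_two]

variable {F : Type*} [Field F] [ValuativeRel F] [TopologicalSpace F]
  [IsNonarchimedeanLocalField F]

lemma chartJac_swap (k l : Fin 2 × Fin 2) (g : GL (Fin 2) F) :
    nabs F (Matrix.of ![steinbergDeriv g k, steinbergDeriv g l]).det =
      nabs F (Matrix.of ![steinbergDeriv g l, steinbergDeriv g k]).det := by
  rw [← nabs_neg]
  congr 1
  simp only [Matrix.det_fin_two, Matrix.of_apply, Matrix.cons_val_zero, Matrix.cons_val_one]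
  ring

set_option synthInstance.maxSize 2000 in
set_option synthInstance.maxHeartbeats 400000 in
/-- Up to the order of the coordinates there are six choices of two matrix entries; the list gives
with each choice the two complementary entries. -/
lemma exists_chart_normal_form : ∀ i j k l : Fin 2 × Fin 2, i ≠ j → i ≠ k → i ≠ l → j ≠ k →
    j ≠ l → k ≠ l →
    ∃ c ∈ ([((0, 0), (1, 0), (0, 1), (1, 1)), ((1, 1), (1, 0), (0, 1), (0, 0)),
        ((0, 0), (0, 1), (1, 0), (1, 1)), ((1, 1), (0, 1), (1, 0), (0, 0)),
        ((1, 0), (0, 1), (0, 0), (1, 1)), ((0, 0), (1, 1), (0, 1), (1, 0))] :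
        List ((Fin 2 × Fin 2) × (Fin 2 × Fin 2) × (Fin 2 × Fin 2) × (Fin 2 × Fin 2))),
      ((i = c.1 ∧ j = c.2.1) ∨ (i = c.2.1 ∧ j = c.1)) ∧
      ((k = c.2.2.1 ∧ l = c.2.2.2) ∨ (k = c.2.2.2 ∧ l = c.2.2.1)) := by
  decide

lemma baseDensity_pos {s : F} (hs : s ≠ 0) : 0 < baseDensity F s :=
  mul_pos (Real.rpow_pos_of_pos (nabs_pos hs) _) (inv_pos.2 (nabs_pos hs))

variable [MeasurableSpace F] [BorelSpace F]

lemma pi_image_eq_prod_image {α : Type*} (p q : α → F) (B : Set α) :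
    Measure.pi (fun _ : Fin 2 => haarF F) ((fun g => ![p g, q g]) '' B) =
      (haarF F).prod (haarF F) ((fun g => (p g, q g)) '' B) := by
  rw [← (measurePreserving_finTwoArrow (haarF F)).measure_preimage_equiv]
  congr 1
  ext v
  simp only [Set.mem_image, Set.mem_preimage]
  refine exists_congr fun g => and_congr_right fun _ => ?_
  rw [← MeasurableEquiv.finTwoArrow.injective.eq_iff]
  rfl

lemma prod_image_swap {α : Type*} (p q : α → F) (B : Set α) :
    (haarF F).prod (haarF F) ((fun g => (q g, p g)) '' B) =
      (haarF F).prod (haarF F) ((fun g => (p g, q g)) '' B) := by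
  have : MeasurePreserving (MeasurableEquiv.prodComm : F × F ≃ᵐ F × F)
      ((haarF F).prod (haarF F)) ((haarF F).prod (haarF F)) :=
    ⟨MeasurableEquiv.measurable _, Measure.prod_swap⟩
  rw [← this.measure_preimage_equiv]
  congr 1
  ext v
  simp only [Set.mem_image, Set.mem_preimage]
  refine exists_congr fun g => and_congr_right fun _ => ?_
  rw [← MeasurableEquiv.prodComm.injective.eq_iff]
  rfl

lemma prod_image_reflect {α : Type*} (a : F) (p q : α → F) (B : Set α) :
    (haarF F).prod (haarF F) ((fun g => (a - p g, q g)) '' B) =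
      (haarF F).prod (haarF F) ((fun g => (p g, q g)) '' B) := by
  have h1 : MeasurePreserving (fun x : F => a - x) (haarF F) (haarF F) :=
    Measure.measurePreserving_sub_left _ a
  have h2 := h1.prod (MeasurePreserving.id (haarF F))
  have hemb : MeasurableEmbedding (Prod.map (fun x : F => a - x) (id : F → F)) :=
    ((MeasurableEquiv.subLeft a).prodCongr (MeasurableEquiv.refl F)).measurableEmbedding
  rw [← h2.measure_preimage_emb hemb]
  congr 1
  ext v
  simp only [Set.mem_image, Set.mem_preimage]
  refine exists_congr fun g => and_congr_right fun _ => ?_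
  rw [← hemb.injective.eq_iff (b := v)]
  simp

lemma measurable_chartJac (e : Fin 4 ≃ Fin 2 × Fin 2) :
    Measurable (chartJac (F := F) e) := by
  have h (k : Fin 2 × Fin 2) (i : Fin 2) :
      Measurable fun g : GL (Fin 2) F => steinbergDeriv g k i := by
    obtain ⟨k, l⟩ := k
    fin_cases k <;> fin_cases l <;> fin_cases i <;>
      simp [steinbergDeriv, Matrix.adjugate_fin_two] <;> fun_prop
  have e1 : chartJac (F := F) e = fun g => steinbergDeriv g (e 2) 0 * steinbergDeriv g (e 3) 1 -
      steinbergDeriv g (e 2) 1 * steinbergDeriv g (e 3) 0 := by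
    funext g
    simp [chartJac, Matrix.det_fin_two]
  rw [e1]
  exact ((h _ _).mul (h _ _)).sub ((h _ _).mul (h _ _))

/-- In every chart, `fibreMeasure` is given by the density `|J|⁻¹`. -/
lemma lintegral_chartJac_fibreMeasure (hp : ringChar 𝓀[F] ≠ 2) {a s : F} (hs : s ≠ 0)
    (e : Fin 4 ≃ Fin 2 × Fin 2) {B : Set (GL (Fin 2) F)} (hBm : MeasurableSet B)
    (hB : B ⊆ steinberg ⁻¹' {(a, s)}) (hJ : ∀ g ∈ B, chartJac e g ≠ 0)
    (hinj : Set.InjOn (chartCoord e) B) :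
    ∫⁻ g in B, ENNReal.ofReal (nabs F (chartJac e g)) ∂fibreMeasure a s =
      Measure.pi (fun _ : Fin 2 => haarF F) (chartCoord e '' B) := by
  obtain ⟨⟨i, j, k, l⟩, hcase, hij, hkl⟩ := exists_chart_normal_form (e 0) (e 1) (e 2) (e 3)
    (by simp) (by simp) (by simp) (by simp) (by simp) (by simp)
  have hpi : Measure.pi (fun _ : Fin 2 => haarF F) (chartCoord e '' B) =
      (haarF F).prod (haarF F)
        ((fun g : GL (Fin 2) F => (g.val i.1 i.2, g.val j.1 j.2)) '' B) := by
    have h1 := pi_image_eq_prod_image (fun g : GL (Fin 2) F => g.val (e 0).1 (e 0).2)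
      (fun g => g.val (e 1).1 (e 1).2) B
    refine Eq.trans h1 ?_
    rcases hij with ⟨h, h'⟩ | ⟨h, h'⟩
    · rw [h, h']
    · rw [h, h', prod_image_swap]
  have hjac (g : GL (Fin 2) F) : nabs F (chartJac e g) =
      nabs F (Matrix.of ![steinbergDeriv g k, steinbergDeriv g l]).det := by
    rcases hkl with ⟨h, h'⟩ | ⟨h, h'⟩
    · rw [chartJac, h, h']
    · rw [chartJac, h, h', chartJac_swap]
  have hJ' (g : GL (Fin 2) F) (hg : g ∈ B) :
      (Matrix.of ![steinbergDeriv g k, steinbergDeriv g l]).det ≠ 0 := by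
    rw [Ne, ← nabs_eq_zero, ← hjac, nabs_eq_zero]
    exact hJ g hg
  have hinj' : Set.InjOn (fun g : GL (Fin 2) F => (g.val i.1 i.2, g.val j.1 j.2)) B := by
    intro g hg g' hg' h
    refine hinj hg hg' ?_
    have h1 := congrArg Prod.fst h
    have h2 := congrArg Prod.snd h
    simp only at h1 h2
    rcases hij with ⟨h3, h4⟩ | ⟨h3, h4⟩
    · rw [chartCoord, chartCoord, h3, h4, h1, h2]
    · rw [chartCoord, chartCoord, h3, h4, h1, h2]
  have hw (g : GL (Fin 2) F) (hg : g ∈ B) : g.val 1 1 = a - g.val 0 0 :=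
    (mem_steinberg_fibre.1 (hB hg)).1
  simp_rw [hjac]
  rw [hpi]
  clear hpi hjac hij hkl hJ hinj
  simp only [List.mem_cons, List.not_mem_nil, or_false, Prod.mk.injEq] at hcase
  rcases hcase with h | h | h | h | h | h <;>
    obtain ⟨rfl, rfl, rfl, rfl⟩ := h <;>
    simp only [steinbergDeriv_eq, Matrix.det_fin_two, Matrix.of_apply, Matrix.cons_val_zero,
      Matrix.cons_val_one, zero_mul, mul_one, one_mul, mul_zero,
      ne_eq, sub_self, sub_neg_eq_add, zero_add, not_true_eq_false] at hJ' ⊢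
  · exact (fibreMeasure_chart_column hs hBm hB hJ').symm
  · rw [← fibreMeasure_chart_column hs hBm hB hJ', ← prod_image_reflect a]
    refine congrArg _ (Set.image_congr fun g hg => ?_)
    rw [hw g hg]
  · exact (fibreMeasure_chart_row hs hBm hB hJ').symm
  · rw [← fibreMeasure_chart_row hs hBm hB hJ', ← prod_image_reflect a]
    refine congrArg _ (Set.image_congr fun g hg => ?_)
    rw [hw g hg]
  · have hsymm (g : GL (Fin 2) F) : nabs F (g.val 0 0 - g.val 1 1) =
        nabs F (g.val 1 1 - g.val 0 0) := nabs_sub_comm _ _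
    simp_rw [hsymm]
    refine (fibreMeasure_chart_antidiagonal hp hs hBm hB (fun g hg h => hJ' g hg ?_) hinj').symm
    rw [← neg_sub, h, neg_zero]
  -- the sum of the diagonal entries is constant on the fibre, so they are nowhere coordinates
  · have : B = ∅ := Set.eq_empty_of_forall_notMem hJ'
    simp [this]

lemma isGeometricMeasure_fibreMeasure (hp : ringChar 𝓀[F] ≠ 2) (a : F) {s : F} (hs : s ≠ 0) :
    IsGeometricMeasure (a, s)
      ((ENNReal.ofReal (groupDensity F s) / ENNReal.ofReal (baseDensity F s)) •
        fibreMeasure a s) where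
  supported := by
    rw [Measure.smul_apply, fibreMeasure_compl a hs, smul_zero]
  chart e B hBm hB hJ hinj := by
    rw [← lintegral_chartJac_fibreMeasure hp hs e hBm hB hJ hinj, Measure.restrict_smul,
      lintegral_smul_measure, smul_eq_mul, ← mul_assoc,
      ENNReal.mul_div_cancel (ENNReal.ofReal_pos.2 (baseDensity_pos hs)).ne'
        ENNReal.ofReal_ne_top]

lemma exists_entry_equiv {v : Fin 4 → Fin 2 × Fin 2} (hv : Function.Injective v) :
    ∃ e : Fin 4 ≃ Fin 2 × Fin 2, ⇑e = v :=
  ⟨Equiv.ofBijective v ((Fintype.bijective_iff_injective_and_card v).2 ⟨hv, by simp⟩), rfl⟩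

section Uniqueness

variable {a s : F} {μ : Measure (GL (Fin 2) F)} {B : Set (GL (Fin 2) F)}

lemma IsGeometricMeasure.lintegral_column (h : IsGeometricMeasure (a, s) μ) (hs : s ≠ 0)
    (hBm : MeasurableSet B) (hB : B ⊆ steinberg ⁻¹' {(a, s)}) (hB0 : ∀ g ∈ B, g.val 1 0 ≠ 0) :
    ENNReal.ofReal (baseDensity F s) * ∫⁻ g in B, ENNReal.ofReal (nabs F (g.val 1 0)) ∂μ =
      ENNReal.ofReal (groupDensity F s) *
        (haarF F).prod (haarF F) ((fun g => (g.val 0 0, g.val 1 0)) '' B) := by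
  obtain ⟨e, he⟩ := exists_entry_equiv (v := ![(0, 0), (1, 0), (0, 1), (1, 1)]) (by decide)
  have hJ (g : GL (Fin 2) F) : chartJac e g = g.val 1 0 := by
    simp [chartJac, he, steinbergDeriv_eq, Matrix.det_fin_two]
  have hc (g : GL (Fin 2) F) : chartCoord e g = ![g.val 0 0, g.val 1 0] := by
    simp [chartCoord, he]
  have := h.chart e B hBm hB (fun g hg => by rw [hJ]; exact hB0 g hg) ?_
  · simp_rw [hJ] at this
    rw [← pi_image_eq_prod_image, this]
    simp_rw [← hc]
  · intro g hg g' hg' hgg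
    rw [hc, hc] at hgg
    have h0 := congrFun hgg 0
    have h1 := congrFun hgg 1
    simp only [Matrix.cons_val_zero, Matrix.cons_val_one, Matrix.cons_val_fin_one] at h0 h1
    rw [← fibrePoint_column hs (hB hg) (hB0 g hg), ← fibrePoint_column hs (hB hg') (hB0 g' hg'),
      h0, h1]

/-- A set contained in one chart, and with a null set of coordinates, is null. -/
lemma IsGeometricMeasure.null_of_chart (h : IsGeometricMeasure (a, s) μ) (hs : s ≠ 0)
    {v : Fin 4 → Fin 2 × Fin 2} (hv : Function.Injective v) (hBm : MeasurableSet B)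
    (hB : B ⊆ steinberg ⁻¹' {(a, s)})
    (hJ : ∀ g ∈ B, (Matrix.of ![steinbergDeriv g (v 2), steinbergDeriv g (v 3)]).det ≠ 0)
    (hinj : Set.InjOn
      (fun g : GL (Fin 2) F => (g.val (v 0).1 (v 0).2, g.val (v 1).1 (v 1).2)) B)
    {R : Set F} (hR : R.Countable) (hBR : ∀ g ∈ B, g.val (v 0).1 (v 0).2 ∈ R) : μ B = 0 := by
  obtain ⟨e, rfl⟩ := exists_entry_equiv hv
  have h1 := h.chart e B hBm hB hJ fun g hg g' hg' hgg =>
    hinj hg hg' (Prod.ext (congrFun hgg 0) (congrFun hgg 1))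
  have h2 : Measure.pi (fun _ : Fin 2 => haarF F) (chartCoord e '' B) = 0 := by
    refine (pi_image_eq_prod_image (fun g : GL (Fin 2) F => g.val (e 0).1 (e 0).2)
      (fun g => g.val (e 1).1 (e 1).2) B).trans (prod_haarF_fst_null hR ?_)
    rintro _ ⟨g, hg, rfl⟩
    exact hBR g hg
  rw [h2, mul_zero, mul_eq_zero, or_iff_right
    (ENNReal.ofReal_pos.2 (baseDensity_pos hs)).ne'] at h1
  have h3 := (setLIntegral_pos_iff (μ := μ) (s := B) (measurable_chartJac e).ofReal_nabs).not
  rw [h1] at h3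
  simp only [lt_self_iff_false, not_false_eq_true, true_iff, not_lt, nonpos_iff_eq_zero] at h3
  have hsub : B ⊆ Function.support (fun g => ENNReal.ofReal (nabs F (chartJac e g))) ∩ B :=
    fun g hg => ⟨(ENNReal.ofReal_pos.2 (nabs_pos (hJ g hg))).ne', hg⟩
  exact measure_mono_null hsub h3

/-- The locus `x₁₀ = 0` is a null set: it is covered by the chart `(x₀₀, x₀₁)`, except for at most
two points. -/
lemma IsGeometricMeasure.compl_null (h : IsGeometricMeasure (a, s) μ) (hs : s ≠ 0)
    (hd : a ^ 2 - 4 * s ≠ 0) :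
    μ (steinberg ⁻¹' {(a, s)} ∩ {g | g.val 1 0 ≠ 0})ᶜ = 0 := by
  set R := {x : F | x * (a - x) - s = 0} with hR
  have hRc : R.Countable := (finite_roots a s).countable
  set X := steinberg (F := F) ⁻¹' {(a, s)} with hX
  have hXm : MeasurableSet X := measurableSet_fibre _
  have hroot {g : GL (Fin 2) F} (hg : g ∈ X) (hz : g.val 1 0 = 0) : g.val 0 0 ∈ R := by
    have := (mem_steinberg_fibre.1 hg).2
    rw [hz, mul_zero] at this
    exact this.symm
  have hzm (i j : Fin 2) : MeasurableSet {g : GL (Fin 2) F | g.val i j = 0} :=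
    measurable_entry i j (measurableSet_singleton 0)
  have h1 : μ (X ∩ {g | g.val 1 0 = 0} ∩ {g | g.val 0 1 = 0}ᶜ) = 0 := by
    refine h.null_of_chart hs (v := ![(0, 0), (0, 1), (1, 0), (1, 1)]) (by decide)
      ((hXm.inter (hzm _ _)).inter (hzm _ _).compl) (fun g hg => hg.1.1) ?_ ?_ hRc
      (fun g hg => hroot hg.1.1 hg.1.2)
    · intro g hg
      simpa [steinbergDeriv_eq, Matrix.det_fin_two] using hg.2
    · rintro g ⟨⟨hg, hgz⟩, -⟩ g' ⟨⟨hg', hgz'⟩, -⟩ he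
      have h0 := congrArg Prod.fst he
      have h1 := congrArg Prod.snd he
      simp only [Matrix.cons_val_zero, Matrix.cons_val_one] at h0 h1
      have hz : g.val 1 0 = 0 := hgz
      have hz' : g'.val 1 0 = 0 := hgz'
      have hw := (mem_steinberg_fibre.1 hg).1
      have hw' := (mem_steinberg_fibre.1 hg').1
      ext i j
      fin_cases i <;> fin_cases j <;> simp [h0, h1, hz, hz', hw, hw']
  have h2 : μ (⋃ x ∈ R, X ∩ {g | g.val 1 0 = 0} ∩ {g | g.val 0 1 = 0} ∩
      {g | g.val 0 0 = x}) = 0 := by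
    refine (measure_biUnion_null_iff hRc).2 fun x hx => ?_
    refine h.null_of_chart hs (v := ![(1, 0), (0, 1), (0, 0), (1, 1)]) (by decide)
      (((hXm.inter (hzm _ _)).inter (hzm _ _)).inter
        (measurable_entry 0 0 (measurableSet_singleton x))) (fun g hg => hg.1.1.1) ?_ ?_
      (Set.countable_singleton 0) (fun g hg => hg.1.1.2)
    · rintro g ⟨⟨⟨hg, hz⟩, hy⟩, -⟩ hJ
      have hz' : g.val 1 0 = 0 := hz
      have hdisc := disc_of_mem_fibre hg
      have hJ' : g.val 0 0 - g.val 1 1 = 0 := by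
        simpa [steinbergDeriv_eq, Matrix.det_fin_two] using hJ
      rw [hJ', hz'] at hdisc
      exact hd (by simpa using hdisc.symm)
    · rintro g ⟨⟨⟨hg, hgz⟩, hgy⟩, hgx⟩ g' ⟨⟨⟨hg', hgz'⟩, hgy'⟩, hgx'⟩ -
      have hz : g.val 1 0 = 0 := hgz
      have hz' : g'.val 1 0 = 0 := hgz'
      have hy : g.val 0 1 = 0 := hgy
      have hy' : g'.val 0 1 = 0 := hgy'
      have hx : g.val 0 0 = x := hgx
      have hx' : g'.val 0 0 = x := hgx'
      have hw := (mem_steinberg_fibre.1 hg).1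
      have hw' := (mem_steinberg_fibre.1 hg').1
      ext i j
      fin_cases i <;> fin_cases j <;> simp [hz, hz', hw, hw', hy, hy', hx, hx']
  refine measure_mono_null (fun g hg => ?_)
    (measure_union_null h.supported (measure_union_null h1 h2))
  by_cases hgX : g ∈ X
  · have hz : g.val 1 0 = 0 := by
      by_contra hz
      exact hg ⟨hgX, hz⟩
    by_cases hy : g.val 0 1 = 0
    · exact Or.inr (Or.inr (Set.mem_biUnion (hroot hgX hz) ⟨⟨⟨hgX, hz⟩, hy⟩, rfl⟩))
    · exact Or.inr (Or.inl ⟨⟨hgX, hz⟩, hy⟩)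
  · exact Or.inl hgX

/-- The chart `(x₀₀, x₁₀)` determines a geometric measure on the complement of a null set. -/
lemma IsGeometricMeasure.unique {μ' : Measure (GL (Fin 2) F)} (h : IsGeometricMeasure (a, s) μ)
    (h' : IsGeometricMeasure (a, s) μ') (hs : s ≠ 0) (hd : a ^ 2 - 4 * s ≠ 0) : μ = μ' := by
  set Z : Set (GL (Fin 2) F) := steinberg ⁻¹' {(a, s)} ∩ {g | g.val 1 0 ≠ 0} with hZ
  have hZm : MeasurableSet Z := (measurableSet_fibre _).inter
    (measurable_entry 1 0 (measurableSet_singleton 0).compl)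
  set w : GL (Fin 2) F → ENNReal := fun g => ENNReal.ofReal (nabs F (g.val 1 0)) with hw
  have hwm : Measurable w := (measurable_entry 1 0).ofReal_nabs
  have hrestr {ν : Measure (GL (Fin 2) F)} (hν : IsGeometricMeasure (a, s) ν) :
      ν.restrict Z = ν :=
    Measure.restrict_eq_self_of_ae_mem (by simpa [mem_ae_iff] using hν.compl_null hs hd)
  have hinv {ν : Measure (GL (Fin 2) F)} :
      ((ν.restrict Z).withDensity w).withDensity (w⁻¹) = ν.restrict Z := by
    refine withDensity_inv_same hwm ?_ (Filter.Eventually.of_forall fun g => ENNReal.ofReal_ne_top)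
    refine (ae_restrict_iff' hZm).2 (Filter.Eventually.of_forall fun g hg => ?_)
    exact (ENNReal.ofReal_pos.2 (nabs_pos hg.2)).ne'
  have heq : (μ.restrict Z).withDensity w = (μ'.restrict Z).withDensity w := by
    ext B hB
    have key {ν : Measure (GL (Fin 2) F)} (hν : IsGeometricMeasure (a, s) ν) :=
      hν.lintegral_column hs (hB.inter hZm) (fun g hg => hg.2.1) (fun g hg => hg.2.2)
    rw [withDensity_apply _ hB, withDensity_apply _ hB, Measure.restrict_restrict hB,
      Measure.restrict_restrict hB]
    refine (ENNReal.mul_right_inj (ENNReal.ofReal_pos.2 (baseDensity_pos hs)).ne'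
      ENNReal.ofReal_ne_top).1 ?_
    rw [key h, key h']
  rw [← hrestr h, ← hrestr h', ← hinv (ν := μ), ← hinv (ν := μ'), heq]

end Uniqueness

lemma existsUnique_isGeometricMeasure (hp : ringChar 𝓀[F] ≠ 2) {a s : F} (hs : s ≠ 0)
    (hd : a ^ 2 - 4 * s ≠ 0) : ∃! μ : Measure (GL (Fin 2) F), IsGeometricMeasure (a, s) μ :=
  ⟨_, isGeometricMeasure_fibreMeasure hp a hs, fun _ h =>
    h.unique (isGeometricMeasure_fibreMeasure hp a hs) hs hd⟩

lemma geometricMeasure_eq (hp : ringChar 𝓀[F] ≠ 2) {a s : F} (hs : s ≠ 0)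
    (hd : a ^ 2 - 4 * s ≠ 0) :
    geometricMeasure (a, s) =
      (ENNReal.ofReal (groupDensity F s) / ENNReal.ofReal (baseDensity F s)) •
        fibreMeasure a s := by
  have h : ∃ μ : Measure (GL (Fin 2) F), IsGeometricMeasure (a, s) μ :=
    ⟨_, isGeometricMeasure_fibreMeasure hp a hs⟩
  rw [geometricMeasure, dif_pos h]
  exact h.choose_spec.unique (isGeometricMeasure_fibreMeasure hp a hs) hs hd

end GeometricMeasure

/-! ### Conjugacy classes -/

section Conjugacy

variable {F : Type*} [Field F]

/-- A matrix with a cyclic vector `(v, w)` is conjugate to a companion matrix. -/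
lemma isConj_fibrePoint_of_cyclic {g : GL (Fin 2) F} {a s : F} (hs : s ≠ 0)
    (hg : g ∈ steinberg ⁻¹' {(a, s)}) (v w : F)
    (h : v * (g.val 1 0 * v + g.val 1 1 * w) - (g.val 0 0 * v + g.val 0 1 * w) * w ≠ 0) :
    IsConj (fibrePoint a s (0, 1)) g := by
  have hg' := mem_steinberg_fibre.1 hg
  refine isConj_iff.2 ⟨Matrix.GeneralLinearGroup.mkOfDetNeZero
    !![v, g.val 0 0 * v + g.val 0 1 * w; w, g.val 1 0 * v + g.val 1 1 * w]
    (by rwa [Matrix.det_fin_two_of]), ?_⟩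
  rw [mul_inv_eq_iff_eq_mul]
  ext i j
  have hC := fibrePoint_val (a := a) (p := ((0 : F), (1 : F))) hs one_ne_zero
  simp only [Matrix.GeneralLinearGroup.coe_mul, hC, Matrix.GeneralLinearGroup.mkOfDetNeZero,
    Matrix.GeneralLinearGroup.mk', Matrix.unitOfDetInvertible, Matrix.mul_apply, Fin.sum_univ_two]
  have h1 : g.val 1 1 = a - g.val 0 0 := hg'.1
  have h2 := hg'.2
  fin_cases i <;> fin_cases j <;> simp [h1]
  · linear_combination (-v) * h2
  · linear_combination (-w) * h2

/-- The fibre of the Steinberg map through a regular semisimple element is its conjugacy class. -/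
lemma conjugatesOf_eq_fibre {g : GL (Fin 2) F} (hd : g.val.trace ^ 2 - 4 * g.val.det ≠ 0) :
    conjugatesOf g = steinberg ⁻¹' {steinberg g} := by
  have hconj {b : GL (Fin 2) F} (hb : b ∈ steinberg ⁻¹' {(g.val.trace, g.val.det)}) :
      IsConj (fibrePoint g.val.trace g.val.det (0, 1)) b := by
    have hs : g.val.det ≠ 0 := steinberg_ne_zero g
    by_cases hz : b.val 1 0 = 0
    · by_cases hy : b.val 0 1 = 0
      · refine isConj_fibrePoint_of_cyclic hs hb 1 1 fun h => hd ?_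
        rw [← disc_of_mem_fibre hb]
        simp only [hz, hy] at h ⊢
        linear_combination (b.val 1 1 - b.val 0 0) * h
      · exact isConj_fibrePoint_of_cyclic hs hb 0 1 (by simpa using hy)
    · exact isConj_fibrePoint_of_cyclic hs hb 1 0 (by simpa using hz)
  ext b
  constructor
  · intro hb
    obtain ⟨c, rfl⟩ := isConj_iff.1 (show IsConj g b from hb)
    have h1 : (c * g * c⁻¹).val.trace = g.val.trace := by
      rw [Units.val_mul, Matrix.trace_mul_comm, ← Units.val_mul, ← mul_assoc, inv_mul_cancel,
        one_mul]
    have h2 : (c * g * c⁻¹).val.det = g.val.det := by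
      rw [Units.val_mul, Matrix.det_mul_comm, ← Units.val_mul, ← mul_assoc, inv_mul_cancel,
        one_mul]
    exact Prod.ext h1 h2
  · intro hb
    exact (hconj (b := g) rfl).symm.trans (hconj hb)

end Conjugacy

/-! ### The maximal compact subgroup and its volume -/

section MaxCompact

lemma exists_map_eq_of_integer {F : Type*} [Field F] [ValuativeRel F]
    (M : Matrix (Fin 2) (Fin 2) 𝒪[F]) (hM : IsUnit M.det)
    {g : GL (Fin 2) F} (hg : ∀ i j, g.val i j = (M i j : F)) : g ∈ maxCompact F := by
  obtain ⟨u, hu⟩ := (Matrix.isUnit_iff_isUnit_det M).2 hM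
  refine ⟨u, ?_⟩
  ext i j
  rw [Matrix.GeneralLinearGroup.map_apply, hu, hg]
  rfl

variable {F : Type*} [Field F] [ValuativeRel F] [TopologicalSpace F]
  [IsNonarchimedeanLocalField F]

lemma mem_maxCompact_iff {g : GL (Fin 2) F} :
    g ∈ maxCompact F ↔ (∀ i j, nabs F (g.val i j) ≤ 1) ∧ nabs F g.val.det = 1 := by
  constructor
  · rintro ⟨h, rfl⟩
    refine ⟨fun i j => ?_, ?_⟩
    · rw [Matrix.GeneralLinearGroup.map_apply]
      exact mem_integer_iff.1 (h.val i j).2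
    · have h1 : IsUnit h.val.det := h.isUnit.map Matrix.detMonoidHom
      have h2 := isUnit_integer_iff.1 h1
      convert h2 using 2
      simp [Matrix.det_fin_two]
      rfl
  · rintro ⟨h1, h2⟩
    refine exists_map_eq_of_integer
      (Matrix.of fun i j => (⟨g.val i j, mem_integer_iff.2 (h1 i j)⟩ : 𝒪[F])) ?_
      (fun i j => rfl)
    rw [isUnit_integer_iff]
    rw [Matrix.det_fin_two] at h2 ⊢
    simpa using h2

/-- `GL₂(𝒪)` is the union of the residue classes indexed by `GL₂` of the residue field. -/
lemma image_maxCompact : (fun (g : GL (Fin 2) F) (k : Fin 2 × Fin 2) => g.val k.1 k.2) ''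
    (maxCompact F : Set (GL (Fin 2) F)) =
      ⋃ h : GL (Fin 2) 𝓀[F], Set.univ.pi fun k : Fin 2 × Fin 2 =>
        {x : F | nabs F (x - (residueLift (h.val k.1 k.2) : F)) < 1} := by
  ext v
  simp only [Set.mem_iUnion, Set.mem_univ_pi, Set.mem_ofPred_eq]
  constructor
  · rintro ⟨_, ⟨h, rfl⟩, rfl⟩
    refine ⟨Matrix.GeneralLinearGroup.map (IsLocalRing.residue 𝒪[F]) h, fun k => ?_⟩
    exact residue_eq_iff.1 rfl
  · rintro ⟨h, hv⟩
    have hO (k : Fin 2 × Fin 2) : v k ∈ 𝒪[F] :=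
      mem_integer_of_nabs_sub_lt (residueLift (h.val k.1 k.2)).2 (hv k)
    set M : Matrix (Fin 2) (Fin 2) 𝒪[F] := Matrix.of fun i j => ⟨v (i, j), hO (i, j)⟩ with hM
    have hMh : (IsLocalRing.residue 𝒪[F]).mapMatrix M = h.val := by
      ext i j
      exact residue_eq_iff.2 (hv (i, j))
    have hdet : IsUnit M.det := by
      have h1 : IsUnit h.val.det := h.isUnit.map Matrix.detMonoidHom
      rw [← hMh, ← RingHom.map_det] at h1
      exact (isUnit_map_iff (IsLocalRing.residue 𝒪[F]) _).1 h1
    obtain ⟨u, hu⟩ := (Matrix.isUnit_iff_isUnit_det M).2 hdet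
    refine ⟨_, ⟨u, rfl⟩, ?_⟩
    funext k
    simp only [Matrix.GeneralLinearGroup.map_apply, hu]
    rfl

variable [MeasurableSpace F] [BorelSpace F]

variable (F) in
/-- The volume of `GL₂(𝒪)` is the number of elements of `GL₂` of the residue field, divided by
`q ^ 4`. -/
lemma volMaxCompact_eq :
    volMaxCompact F = (1 - 1 / (resCard F : ℝ)) * (1 - 1 / (resCard F : ℝ) ^ 2) := by
  have := Fintype.ofFinite 𝓀[F]
  classical
  have hq := resCard_pos F
  rw [volMaxCompact, image_maxCompact, measure_iUnion]
  · simp only [Measure.pi_pi, haarF_open_ball, haarF_maximalIdeal]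
    have hcard := Matrix.card_GL_field (𝔽 := 𝓀[F]) 2
    rw [Nat.card_eq_fintype_card, Fin.prod_univ_two] at hcard
    rw [tsum_fintype, Finset.sum_const, Finset.card_univ, hcard, Finset.prod_const,
      Finset.card_univ]
    have hqc : Fintype.card 𝓀[F] = resCard F := by rw [resCard, Nat.card_eq_fintype_card]
    have hq1 : 1 ≤ resCard F := by exact_mod_cast (one_lt_resCard F).le
    rw [hqc]
    simp only [Fin.val_zero, pow_zero, Fin.val_one, pow_one, nsmul_eq_mul, ENNReal.toReal_mul,
      ENNReal.toReal_natCast, ENNReal.toReal_pow, ENNReal.toReal_inv, Fintype.card_prod,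
      Fintype.card_fin]
    rw [Nat.cast_mul, Nat.cast_sub (Nat.one_le_pow _ _ hq1),
      Nat.cast_sub (by nlinarith)]
    push_cast
    field_simp
  · intro h h' hne
    refine Set.disjoint_left.2 fun v hv hv' => hne ?_
    ext i j
    by_contra hij
    exact Set.disjoint_left.1 (pairwise_disjoint_residue hij) (hv (i, j) trivial)
      (hv' (i, j) trivial)
  · intro h
    exact MeasurableSet.univ_pi fun k => (isOpen_nabs_sub_lt _ _).measurableSet

lemma measurableSet_maxCompact : MeasurableSet (maxCompact F : Set (GL (Fin 2) F)) := by
  have : (maxCompact F : Set (GL (Fin 2) F)) = (⋂ i, ⋂ j, {g | nabs F (g.val i j) ≤ 1}) ∩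
      {g | nabs F (g.val 0 0 * g.val 1 1 - g.val 0 1 * g.val 1 0) = 1} := by
    ext g
    rw [SetLike.mem_coe, mem_maxCompact_iff, Matrix.det_fin_two]
    simp
  rw [this]
  refine MeasurableSet.inter (MeasurableSet.iInter fun i => MeasurableSet.iInter fun j => ?_) ?_
  · exact (measurable_nabs.comp (measurable_entry i j)) measurableSet_Iic
  · have hc : Continuous fun g : GL (Fin 2) F =>
        nabs F (g.val 0 0 * g.val 1 1 - g.val 0 1 * g.val 1 0) := by fun_prop
    exact (isClosed_eq hc continuous_const).measurableSet

end MaxCompact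

/-! ### The orbital integral as a series -/

section Series

variable {F : Type*} [Field F] [ValuativeRel F] [TopologicalSpace F]
  [IsNonarchimedeanLocalField F]

/-- The integral solutions of the congruence `t ^ 2 ≡ δ` modulo the `n`-th power of the maximal
ideal. -/
def sqrtSet (n : ℕ) (δ : F) : Set F :=
  {t | nabs F t ≤ 1 ∧ nabs F (δ - t ^ 2) ≤ ((resCard F : ℝ) ^ n)⁻¹}

lemma nabs_eq_inv_pow {x : F} (hx : x ≠ 0) (hx1 : nabs F x ≤ 1) :
    ∃ n : ℕ, nabs F x = ((resCard F : ℝ) ^ n)⁻¹ := by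
  rw [nabs_of_ne_zero hx] at hx1 ⊢
  have h0 : -ord F x ≤ 0 := by
    rwa [← zpow_le_zpow_iff_right₀ (one_lt_resCard F), zpow_zero]
  obtain ⟨n, hn⟩ := Int.eq_ofNat_of_zero_le (neg_nonpos.1 h0)
  exact ⟨n, by rw [hn, zpow_neg, zpow_natCast]⟩

variable [MeasurableSpace F] [BorelSpace F]

/-- The volume of the set of integral square roots of `δ` modulo the `n`-th power of the maximal
ideal. -/
def sqrtVol (n : ℕ) (δ : F) : ℝ := (haarF F (sqrtSet n δ)).toReal

lemma haarF_sqrtSet_ne_top (n : ℕ) (δ : F) : haarF F (sqrtSet n δ) ≠ ⊤ := by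
  have h : sqrtSet n δ ⊆ (𝒪[F] : Set F) := fun t ht => mem_integer_iff.2 ht.1
  exact measure_ne_top_of_subset h (by simp)

lemma haarF_nabs_le_pow (n : ℕ) :
    haarF F {x | nabs F x ≤ ((resCard F : ℝ) ^ n)⁻¹} =
      ENNReal.ofReal ((resCard F : ℝ) ^ n)⁻¹ := by
  rw [← nabs_unif_pow, haarF_nabs_le]

lemma haarF_nabs_eq_pow (n : ℕ) :
    haarF F {x | nabs F x = ((resCard F : ℝ) ^ n)⁻¹} =
      ENNReal.ofReal (((resCard F : ℝ) ^ n)⁻¹ * (1 - 1 / (resCard F : ℝ))) := by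
  have hq := resCard_pos F
  have h1 : {x | nabs F x = ((resCard F : ℝ) ^ n)⁻¹} =
      {x | nabs F x ≤ ((resCard F : ℝ) ^ n)⁻¹} \
        {x | nabs F x ≤ ((resCard F : ℝ) ^ (n + 1))⁻¹} := by
    ext x
    have h := nabs_lt_zpow_iff (x := x) (n := -(n : ℤ))
    have e : (-(n : ℤ) - 1) = -((n + 1 : ℕ) : ℤ) := by push_cast; ring
    rw [e, zpow_neg, zpow_neg, zpow_natCast, zpow_natCast] at h
    rw [Set.mem_sdiff, Set.mem_ofPred_eq, Set.mem_ofPred_eq, Set.mem_ofPred_eq, ← h, not_lt,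
      le_antisymm_iff]
  have hsub : {x : F | nabs F x ≤ ((resCard F : ℝ) ^ (n + 1))⁻¹} ⊆
      {x | nabs F x ≤ ((resCard F : ℝ) ^ n)⁻¹} := fun x hx => le_trans hx
    (inv_anti₀ (by positivity) (pow_le_pow_right₀ (one_lt_resCard F).le n.le_succ))
  rw [h1, measure_sdiff hsub (measurable_nabs measurableSet_Iic).nullMeasurableSet,
    haarF_nabs_le_pow, haarF_nabs_le_pow, ← ENNReal.ofReal_sub _ (by positivity)]
  · congr 1
    rw [pow_succ, mul_inv]
    ring
  · rw [haarF_nabs_le_pow]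
    exact ENNReal.ofReal_ne_top

/-- Completing the square identifies the solutions of `x (a - x) ≡ s` with the square roots of
`a ^ 2 / 4 - s`. -/
lemma haarF_quadratic_congruence (hp : ringChar 𝓀[F] ≠ 2) {a : F} (ha : nabs F a ≤ 1) (s : F)
    (n : ℕ) :
    haarF F {x | nabs F x ≤ 1 ∧ nabs F (x * (a - x) - s) ≤ ((resCard F : ℝ) ^ n)⁻¹} =
      haarF F (sqrtSet n (a ^ 2 / 4 - s)) := by
  have h2 := two_ne_zero_of_ringChar hp
  have h4 : (4 : F) ≠ 0 := by
    have : (4 : F) = 2 * 2 := by norm_num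
    rw [this]
    exact mul_ne_zero h2 h2
  have ha2 : nabs F (a / 2) ≤ 1 := by rwa [nabs_div, nabs_two F hp, div_one]
  rw [← haarF_add_left (a / 2)]
  congr 1
  ext t
  simp only [Set.mem_preimage, Set.mem_ofPred_eq, sqrtSet]
  have e : (a / 2 + t) * (a - (a / 2 + t)) - s = a ^ 2 / 4 - s - t ^ 2 := by
    field_simp
    ring
  rw [e]
  refine and_congr_left fun _ => ⟨fun h => ?_, fun h => (nabs_add_le _ _).trans (max_le ha2 h)⟩
  have := (nabs_sub_le (a / 2 + t) (a / 2)).trans (max_le h ha2)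
  simpa using this

/-- The fibre is cut into pieces according to the absolute value `q ^ (-n)` of `x₁₀`. -/
lemma fibreMeasure_maxCompact (hp : ringChar 𝓀[F] ≠ 2) {a s : F} (ha : nabs F a ≤ 1)
    (hs : nabs F s = 1) :
    fibreMeasure a s (maxCompact F : Set (GL (Fin 2) F)) =
      ∑' n : ℕ, ENNReal.ofReal (1 - 1 / (resCard F : ℝ)) *
        haarF F (sqrtSet n (a ^ 2 / 4 - s)) := by
  have hq := resCard_pos F
  have hs0 : s ≠ 0 := by
    rw [Ne, ← nabs_eq_zero, hs]
    exact one_ne_zero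
  rw [← setLIntegral_one, setLIntegral_fibreMeasure _ _ measurableSet_maxCompact measurable_const]
  set D : ℕ → Set (F × F) := fun n =>
    {x | nabs F x ≤ 1 ∧ nabs F (x * (a - x) - s) ≤ ((resCard F : ℝ) ^ n)⁻¹} ×ˢ
      {z | nabs F z = ((resCard F : ℝ) ^ n)⁻¹} with hD
  have hDne (n : ℕ) : ∀ p ∈ D n, p.2 ≠ 0 := by
    intro p hp h0
    have h1 : nabs F p.2 = ((resCard F : ℝ) ^ n)⁻¹ := hp.2
    rw [h0, nabs_zero] at h1
    have : 0 < ((resCard F : ℝ) ^ n)⁻¹ := by positivity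
    exact this.ne h1
  have hset : fibrePoint a s ⁻¹' (maxCompact F : Set (GL (Fin 2) F)) ∩ {p | p.2 ≠ 0} =
      ⋃ n, D n := by
    ext p
    have hmem (hp0 : p.2 ≠ 0) : fibrePoint a s p ∈ maxCompact F ↔
        nabs F p.1 ≤ 1 ∧ nabs F (p.1 * (a - p.1) - s) ≤ nabs F p.2 ∧ nabs F p.2 ≤ 1 := by
      rw [mem_maxCompact_iff, fibrePoint_val hs0 hp0]
      have hdet : !![p.1, (p.1 * (a - p.1) - s) / p.2; p.2, a - p.1].det = s := by
        rw [Matrix.det_fin_two_of]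
        field_simp
        ring
      rw [hdet]
      simp only [Fin.forall_fin_two, Matrix.of_apply, Matrix.cons_val', Matrix.cons_val_zero,
        Matrix.cons_val_one, Matrix.cons_val_fin_one, nabs_div, div_le_one (nabs_pos hp0), hs,
        and_true]
      constructor
      · rintro ⟨⟨h1, h2⟩, h3, -⟩
        exact ⟨h1, h2, h3⟩
      · rintro ⟨h1, h2, h3⟩
        exact ⟨⟨h1, h2⟩, h3, (nabs_sub_le _ _).trans (max_le ha h1)⟩
    rw [Set.mem_iUnion]
    constructor
    · rintro ⟨hpK, hp0⟩
      obtain ⟨h1, h2, h3⟩ := (hmem hp0).1 hpK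
      obtain ⟨n, hn⟩ := nabs_eq_inv_pow hp0 h3
      exact ⟨n, ⟨h1, hn ▸ h2⟩, hn⟩
    · rintro ⟨n, hn⟩
      have hp0 := hDne n p hn
      obtain ⟨⟨h1, h2⟩, h3⟩ := hn
      have h3' : nabs F p.2 = ((resCard F : ℝ) ^ n)⁻¹ := h3
      refine ⟨(hmem hp0).2 ⟨h1, h3' ▸ h2, h3' ▸ ?_⟩, hp0⟩
      exact inv_le_one_of_one_le₀ (one_le_pow₀ (one_lt_resCard F).le)
  have hc : Continuous fun x : F => nabs F (x * (a - x) - s) := by fun_prop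
  have hDm (n : ℕ) : MeasurableSet (D n) :=
    ((measurable_nabs measurableSet_Iic).inter (hc.measurable measurableSet_Iic)).prod
      (measurable_nabs (measurableSet_singleton _))
  have hDd : Pairwise (Function.onFun Disjoint D) := by
    intro m n hmn
    refine Set.disjoint_left.2 fun p hp hp' => hmn ?_
    have h1 : nabs F p.2 = ((resCard F : ℝ) ^ m)⁻¹ := hp.2
    have h2 : nabs F p.2 = ((resCard F : ℝ) ^ n)⁻¹ := hp'.2
    exact pow_right_injective₀ hq (one_lt_resCard F).ne' (inv_injective (h1.symm.trans h2))
  rw [hset, lintegral_iUnion hDm hDd]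
  refine tsum_congr fun n => ?_
  rw [setLIntegral_congr_fun (hDm n) (g := fun _ => ENNReal.ofReal ((resCard F : ℝ) ^ n))]
  · rw [setLIntegral_const, hD, Measure.prod_prod, haarF_quadratic_congruence hp ha,
      haarF_nabs_eq_pow, mul_comm (haarF F _), ← mul_assoc, ← ENNReal.ofReal_mul (by positivity)]
    congr 2
    field_simp
  · intro p hp
    have h1 : nabs F p.2 = ((resCard F : ℝ) ^ n)⁻¹ := hp.2
    simp only [h1, inv_inv, mul_one]

lemma orbitalIntegral_f₀ {g : GL (Fin 2) F} (hd : g.val.trace ^ 2 - 4 * g.val.det ≠ 0) :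
    orbitalIntegral g (f₀ F) =
      ((geometricMeasure (steinberg g)).restrict (steinberg ⁻¹' {steinberg g})).real
        (maxCompact F : Set (GL (Fin 2) F)) := by
  rw [orbitalIntegral, f₀, conjugatesOf_eq_fibre hd, integral_indicator_one
    measurableSet_maxCompact]

/-- An element of non-integral trace has no conjugate in `GL₂(𝒪)`. -/
lemma orbitalIntegral_eq_zero {g : GL (Fin 2) F} (hd : g.val.trace ^ 2 - 4 * g.val.det ≠ 0)
    (h : ¬ nabs F g.val.trace ≤ 1) : orbitalIntegral g (f₀ F) = 0 := by
  rw [orbitalIntegral_f₀ hd, Measure.real, Measure.restrict_apply measurableSet_maxCompact]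
  have : (maxCompact F : Set (GL (Fin 2) F)) ∩ steinberg ⁻¹' {steinberg g} = ∅ := by
    ext b
    simp only [Set.mem_inter_iff, SetLike.mem_coe, Set.mem_empty_iff_false, iff_false, not_and]
    intro hb hb'
    have h1 : b.val.trace = g.val.trace := congrArg Prod.fst hb'
    rw [← h1, Matrix.trace_fin_two] at h
    have h2 := (mem_maxCompact_iff.1 hb).1
    exact h ((nabs_add_le _ _).trans (max_le (h2 0 0) (h2 1 1)))
  simp [this]

/-- The orbital integral of `f₀` counts the square roots of `(tr g) ^ 2 / 4 - det g` modulo all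
powers of the maximal ideal. -/
lemma orbitalIntegral_eq_tsum (hp : ringChar 𝓀[F] ≠ 2) {g : GL (Fin 2) F}
    (hd : g.val.trace ^ 2 - 4 * g.val.det ≠ 0) (ha : nabs F g.val.trace ≤ 1)
    (hs : nabs F g.val.det = 1) :
    orbitalIntegral g (f₀ F) = (1 - 1 / (resCard F : ℝ) ^ 2)⁻¹ *
      ∑' n : ℕ, sqrtVol n (g.val.trace ^ 2 / 4 - g.val.det) := by
  have hq := one_lt_resCard F
  have hq1 : (0 : ℝ) < 1 - 1 / (resCard F : ℝ) := by
    rw [sub_pos, div_lt_one (by linarith)]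
    exact hq
  have hs0 : g.val.det ≠ 0 := steinberg_ne_zero g
  rw [orbitalIntegral_f₀ hd]
  have e : steinberg g = (g.val.trace, g.val.det) := rfl
  have hae : (fibreMeasure g.val.trace g.val.det).restrict
      (steinberg ⁻¹' {(g.val.trace, g.val.det)}) = fibreMeasure g.val.trace g.val.det :=
    Measure.restrict_eq_self_of_ae_mem (mem_ae_iff.2 (fibreMeasure_compl _ hs0))
  rw [e, geometricMeasure_eq hp hs0 hd, Measure.restrict_smul, hae,
    Measure.real, Measure.smul_apply, smul_eq_mul, fibreMeasure_maxCompact hp ha hs,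
    ENNReal.toReal_mul, ENNReal.tsum_mul_left, ENNReal.toReal_mul,
    ENNReal.tsum_toReal_eq fun n => haarF_sqrtSet_ne_top n _, ENNReal.toReal_ofReal hq1.le,
    ENNReal.toReal_div, groupDensity, baseDensity, hs, volMaxCompact_eq]
  have hv : 0 < 1 - 1 / (resCard F : ℝ) ^ 2 := by
    rw [sub_pos, div_lt_one (by positivity)]
    exact one_lt_pow₀ hq two_ne_zero
  rw [ENNReal.toReal_ofReal (by positivity), ENNReal.toReal_ofReal (by simp)]
  simp only [Real.one_rpow, one_pow, inv_one, mul_one, div_one]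
  rw [← mul_assoc]
  congr 1
  rw [mul_inv, mul_right_comm, inv_mul_cancel₀ hq1.ne', one_mul]

end Series

/-! ### Counting square roots -/

section SquareRoots

variable {F : Type*} [Field F] [ValuativeRel F] [TopologicalSpace F]
  [IsNonarchimedeanLocalField F]

lemma inv_pow_le_inv_pow_iff {m n : ℕ} :
    ((resCard F : ℝ) ^ m)⁻¹ ≤ ((resCard F : ℝ) ^ n)⁻¹ ↔ n ≤ m := by
  have hq := resCard_pos F
  rw [inv_le_inv₀ (by positivity) (by positivity), pow_le_pow_iff_right₀ (one_lt_resCard F)]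

lemma inv_pow_lt_inv_pow_iff {m n : ℕ} :
    ((resCard F : ℝ) ^ m)⁻¹ < ((resCard F : ℝ) ^ n)⁻¹ ↔ n < m := by
  rw [← not_le, inv_pow_le_inv_pow_iff, not_le]

/-- Since absolute values are integral powers of `q`, half a power can be rounded up. -/
lemma nabs_sq_le_iff {t : F} {n : ℕ} :
    nabs F t ^ 2 ≤ ((resCard F : ℝ) ^ n)⁻¹ ↔
      nabs F t ≤ ((resCard F : ℝ) ^ ((n + 1) / 2))⁻¹ := by
  have hq := one_lt_resCard F
  have hq0 := resCard_pos F
  by_cases ht : t = 0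
  · simp only [ht, nabs_zero, zero_pow two_ne_zero]
    constructor <;> intro _ <;> positivity
  · rw [nabs_of_ne_zero ht, ← zpow_natCast, ← zpow_natCast, ← zpow_natCast, ← zpow_neg, ← zpow_neg,
      ← zpow_mul, zpow_le_zpow_iff_right₀ hq, zpow_le_zpow_iff_right₀ hq]
    push_cast
    omega

lemma sqrtSet_eq_of_nabs_le {n : ℕ} {δ : F} (h : nabs F δ ≤ ((resCard F : ℝ) ^ n)⁻¹) :
    sqrtSet n δ = {t | nabs F t ≤ ((resCard F : ℝ) ^ ((n + 1) / 2))⁻¹} := by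
  have hq0 := resCard_pos F
  ext t
  rw [sqrtSet, Set.mem_ofPred_eq, Set.mem_ofPred_eq, ← nabs_sq_le_iff, ← nabs_pow]
  constructor
  · rintro ⟨-, h2⟩
    simpa using (nabs_sub_le δ (δ - t ^ 2)).trans (max_le h h2)
  · intro h2
    refine ⟨?_, (nabs_sub_le _ _).trans (max_le h h2)⟩
    rw [nabs_pow] at h2
    refine (nabs_sq_le_iff.1 h2).trans (inv_le_one_of_one_le₀ ?_)
    exact one_le_pow₀ (one_lt_resCard F).le

lemma sqrtSet_congr {n : ℕ} {δ δ' : F} (h : nabs F (δ - δ') ≤ ((resCard F : ℝ) ^ n)⁻¹) :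
    sqrtSet n δ = sqrtSet n δ' := by
  ext t
  refine and_congr_right fun _ => ⟨fun h1 => ?_, fun h1 => ?_⟩
  · have := (nabs_sub_le (δ - t ^ 2) (δ - δ')).trans (max_le h1 h)
    rwa [show δ - t ^ 2 - (δ - δ') = δ' - t ^ 2 by ring] at this
  · have := (nabs_add_le (δ' - t ^ 2) (δ - δ')).trans (max_le h1 h)
    rwa [show δ' - t ^ 2 + (δ - δ') = δ - t ^ 2 by ring] at this

/-- By Hensel's lemma, `δ` is a square as soon as it is one up to a factor in `1 + 𝓂[F]`. -/
lemma sqrtSet_eq_empty (hp : ringChar 𝓀[F] ≠ 2) {n : ℕ} {δ : F} (hδ : ¬ IsSquare δ)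
    (h : ((resCard F : ℝ) ^ n)⁻¹ < nabs F δ) : sqrtSet n δ = ∅ := by
  refine Set.eq_empty_of_forall_notMem fun t ht => hδ ?_
  have hlt : nabs F (δ - t ^ 2) < nabs F δ := ht.2.trans_lt h
  have ht2 : nabs F (t ^ 2) = nabs F δ := by
    have := nabs_add_eq_left (x := δ) (y := -(δ - t ^ 2)) (by rwa [nabs_neg])
    rwa [show δ + -(δ - t ^ 2) = t ^ 2 by ring] at this
  have ht0 : t ≠ 0 := by
    rintro rfl
    have h1 := nabs_nonneg (δ - 0 ^ 2)
    rw [zero_pow two_ne_zero, nabs_zero] at ht2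
    rw [← ht2] at hlt
    exact absurd hlt (not_lt.2 h1)
  obtain ⟨m, hm, -⟩ := exists_sq_eq_one_add hp (m := (δ - t ^ 2) / t ^ 2) (by
    rw [nabs_div, div_lt_one (nabs_pos (pow_ne_zero 2 ht0)), ht2]
    exact hlt)
  refine ⟨t * (1 + m), ?_⟩
  have : t * (1 + m) * (t * (1 + m)) = t ^ 2 * (1 + m) ^ 2 := by ring
  rw [this, hm]
  field_simp
  ring

/-- Above the valuation of `δ = r ^ 2`, the square roots of `δ` modulo a power of the maximal
ideal lie in two disjoint balls about `r` and `-r`. -/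
lemma sqrtSet_sq (hp : ringChar 𝓀[F] ≠ 2) {n d : ℕ} {r : F}
    (hr : nabs F r = ((resCard F : ℝ) ^ d)⁻¹) (hn : 2 * d < n) :
    sqrtSet n (r ^ 2) = {t | nabs F (t - r) ≤ ((resCard F : ℝ) ^ (n - d))⁻¹} ∪
      {t | nabs F (t - -r) ≤ ((resCard F : ℝ) ^ (n - d))⁻¹} := by
  have hq0 := resCard_pos F
  have h2r : nabs F (2 * r) = ((resCard F : ℝ) ^ d)⁻¹ := by
    rw [nabs_mul, nabs_two F hp, hr, one_mul]
  have hprod (t : F) : nabs F (r ^ 2 - t ^ 2) = nabs F (t - r) * nabs F (t - -r) := by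
    rw [← nabs_mul, ← nabs_neg]
    congr 1
    ring
  have hlt : ((resCard F : ℝ) ^ (n - d))⁻¹ < ((resCard F : ℝ) ^ d)⁻¹ :=
    inv_pow_lt_inv_pow_iff.2 (by omega)
  have hmul : ((resCard F : ℝ) ^ (n - d))⁻¹ * ((resCard F : ℝ) ^ d)⁻¹ =
      ((resCard F : ℝ) ^ n)⁻¹ := by
    rw [← mul_inv, ← pow_add, Nat.sub_add_cancel (by omega)]
  have hle1 : ((resCard F : ℝ) ^ d)⁻¹ ≤ 1 :=
    inv_le_one_of_one_le₀ (one_le_pow₀ (one_lt_resCard F).le)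
  -- a point near one root has distance `|2 r|` from the other root
  have near {u : F} {ρ : F} (hρ : nabs F ρ = ((resCard F : ℝ) ^ d)⁻¹)
      (hu : nabs F (u - ρ) ≤ ((resCard F : ℝ) ^ (n - d))⁻¹) :
      nabs F u ≤ 1 ∧ nabs F (u - -ρ) = ((resCard F : ℝ) ^ d)⁻¹ := by
    have h2ρ : nabs F (2 * ρ) = ((resCard F : ℝ) ^ d)⁻¹ := by
      rw [nabs_mul, nabs_two F hp, hρ, one_mul]
    constructor
    · have := (nabs_add_le (u - ρ) ρ).trans (max_le (hu.trans hlt.le) hρ.le)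
      rw [sub_add_cancel] at this
      exact this.trans hle1
    · have := nabs_add_eq_left (x := 2 * ρ) (y := u - ρ) (by rw [h2ρ]; exact hu.trans_lt hlt)
      rwa [show 2 * ρ + (u - ρ) = u - -ρ by ring, h2ρ] at this
  ext t
  simp only [sqrtSet, Set.mem_ofPred_eq, Set.mem_union, hprod]
  constructor
  · rintro ⟨-, h⟩
    have hmax : ((resCard F : ℝ) ^ d)⁻¹ ≤ max (nabs F (t - -r)) (nabs F (t - r)) := by
      have := nabs_sub_le (t - -r) (t - r)
      rwa [show t - -r - (t - r) = 2 * r by ring, h2r] at this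
    have hd0 : 0 < ((resCard F : ℝ) ^ d)⁻¹ := by positivity
    rw [← hmul] at h
    rcases le_max_iff.1 hmax with h1 | h1
    · left
      refine le_of_mul_le_mul_right (le_trans ?_ h) hd0
      exact mul_le_mul_of_nonneg_left h1 (nabs_nonneg _)
    · right
      refine le_of_mul_le_mul_right (le_trans ?_ h) hd0
      rw [mul_comm]
      exact mul_le_mul_of_nonneg_right h1 (nabs_nonneg _)
  · rintro (h | h)
    · obtain ⟨h1, h2⟩ := near hr h
      refine ⟨h1, ?_⟩
      rw [h2, ← hmul]
      exact mul_le_mul_of_nonneg_right h (by positivity)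
    · obtain ⟨h1, h2⟩ := near (ρ := -r) (by rwa [nabs_neg]) h
      rw [neg_neg] at h2
      refine ⟨h1, ?_⟩
      rw [h2, ← hmul, mul_comm]
      exact mul_le_mul_of_nonneg_right h (by positivity)

/-- Whatever `δ` is, its square roots modulo the `n`-th power of the maximal ideal lie in two
balls of radius `q ^ (-n / 2)`. -/
lemma sqrtSet_subset {n : ℕ} {δ t₀ : F} (ht₀ : t₀ ∈ sqrtSet n δ) :
    sqrtSet n δ ⊆ {t | nabs F (t - t₀) ≤ ((resCard F : ℝ) ^ ((n + 1) / 2))⁻¹} ∪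
      {t | nabs F (t - -t₀) ≤ ((resCard F : ℝ) ^ ((n + 1) / 2))⁻¹} := by
  intro t ht
  have h : nabs F (t - t₀) * nabs F (t - -t₀) ≤ ((resCard F : ℝ) ^ n)⁻¹ := by
    have := (nabs_sub_le (δ - t₀ ^ 2) (δ - t ^ 2)).trans (max_le ht₀.2 ht.2)
    rwa [show δ - t₀ ^ 2 - (δ - t ^ 2) = (t - t₀) * (t - -t₀) by ring, nabs_mul] at this
  rw [Set.mem_union, Set.mem_ofPred_eq, Set.mem_ofPred_eq, ← nabs_sq_le_iff, ← nabs_sq_le_iff]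
  rcases le_total (nabs F (t - t₀)) (nabs F (t - -t₀)) with h1 | h1
  · left
    refine le_trans ?_ h
    rw [pow_two]
    exact mul_le_mul_of_nonneg_left h1 (nabs_nonneg _)
  · right
    refine le_trans ?_ h
    rw [pow_two]
    exact mul_le_mul_of_nonneg_right h1 (nabs_nonneg _)

variable (F) in
lemma summable_half_pow : Summable fun n : ℕ => ((resCard F : ℝ) ^ ((n + 1) / 2))⁻¹ := by
  have hq := one_lt_resCard F
  have hq0 := resCard_pos F
  have hg : Summable fun k : ℕ => ((resCard F : ℝ) ^ k)⁻¹ := by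
    simpa using summable_geometric_of_lt_one (inv_nonneg.2 hq0.le) (inv_lt_one_of_one_lt₀ hq)
  have he : Summable fun k : ℕ => ((resCard F : ℝ) ^ ((2 * k + 1) / 2))⁻¹ := by
    refine hg.congr fun k => ?_
    rw [show (2 * k + 1) / 2 = k by omega]
  have ho : Summable fun k : ℕ => ((resCard F : ℝ) ^ ((2 * k + 1 + 1) / 2))⁻¹ := by
    refine ((summable_nat_add_iff 1).2 hg).congr fun k => ?_
    rw [show (2 * k + 1 + 1) / 2 = k + 1 by omega]
  exact (HasSum.even_add_odd (f := fun n : ℕ => ((resCard F : ℝ) ^ ((n + 1) / 2))⁻¹)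
    he.hasSum ho.hasSum).summable

lemma sum_half_pow (d : ℕ) : ∑ n ∈ Finset.range (2 * d + 1), ((resCard F : ℝ) ^ ((n + 1) / 2))⁻¹ =
    (resCard F + 1) / (resCard F - 1) - 2 / (resCard F - 1) * ((resCard F : ℝ) ^ d)⁻¹ := by
  have hq := one_lt_resCard F
  have hq1 : (resCard F : ℝ) - 1 ≠ 0 := by linarith
  have hq0 := resCard_pos F
  induction d with
  | zero =>
    simp
    field_simp
    ring
  | succ d ih =>
    rw [show 2 * (d + 1) + 1 = 2 * d + 1 + 1 + 1 by ring, Finset.sum_range_succ,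
      Finset.sum_range_succ, ih, show (2 * d + 1 + 1) / 2 = d + 1 by omega,
      show (2 * d + 1 + 1 + 1) / 2 = d + 1 by omega, pow_succ]
    field_simp
    ring

variable [MeasurableSpace F] [BorelSpace F]

lemma sqrtVol_of_nabs_le {n : ℕ} {δ : F} (h : nabs F δ ≤ ((resCard F : ℝ) ^ n)⁻¹) :
    sqrtVol n δ = ((resCard F : ℝ) ^ ((n + 1) / 2))⁻¹ := by
  have hq0 := resCard_pos F
  rw [sqrtVol, sqrtSet_eq_of_nabs_le h, haarF_nabs_le_pow, ENNReal.toReal_ofReal (by positivity)]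

lemma sqrtVol_sq (hp : ringChar 𝓀[F] ≠ 2) {n d : ℕ} {r : F}
    (hr : nabs F r = ((resCard F : ℝ) ^ d)⁻¹) (hn : 2 * d < n) :
    sqrtVol n (r ^ 2) = 2 * ((resCard F : ℝ) ^ (n - d))⁻¹ := by
  have hq0 := resCard_pos F
  rw [sqrtVol, sqrtSet_sq hp hr hn, measure_union]
  · rw [haarF_closed_ball, haarF_closed_ball, haarF_nabs_le_pow,
      ← ENNReal.ofReal_add (by positivity) (by positivity), ENNReal.toReal_ofReal (by positivity)]
    ring
  · refine Set.disjoint_left.2 fun t h1 h2 => ?_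
    have h3 := (nabs_sub_le (t - -r) (t - r)).trans (max_le h2 h1)
    rw [show t - -r - (t - r) = 2 * r by ring, nabs_mul, nabs_two F hp, hr, one_mul,
      inv_pow_le_inv_pow_iff] at h3
    omega
  · exact (isClosed_nabs_sub_le _ _).measurableSet

lemma sqrtVol_nonneg (n : ℕ) (δ : F) : 0 ≤ sqrtVol n δ := ENNReal.toReal_nonneg

/-- A bound that does not depend on `δ`, and is summable in `n`. -/
lemma sqrtVol_le (n : ℕ) (δ : F) : sqrtVol n δ ≤ 2 * ((resCard F : ℝ) ^ ((n + 1) / 2))⁻¹ := by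
  have hq0 := resCard_pos F
  rcases Set.eq_empty_or_nonempty (sqrtSet n δ) with h | ⟨t₀, ht₀⟩
  · rw [sqrtVol, h, measure_empty, ENNReal.toReal_zero]
    positivity
  · refine ENNReal.toReal_le_of_le_ofReal (by positivity) ?_
    refine (measure_mono (sqrtSet_subset ht₀)).trans ((measure_union_le _ _).trans_eq ?_)
    rw [haarF_closed_ball, haarF_closed_ball, haarF_nabs_le_pow,
      ← ENNReal.ofReal_add (by positivity) (by positivity)]
    congr 1
    ring

/-- The volume depends only on `δ` modulo the `n`-th power of the maximal ideal. -/
lemma continuous_sqrtVol (n : ℕ) : Continuous (sqrtVol (F := F) n) := by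
  have hq0 := resCard_pos F
  refine IsLocallyConstant.continuous ((IsLocallyConstant.iff_exists_open _).2 fun δ => ?_)
  refine ⟨{δ' | nabs F (δ' - δ) < ((resCard F : ℝ) ^ n)⁻¹}, isOpen_nabs_sub_lt _ _, ?_, ?_⟩
  · rw [Set.mem_ofPred_eq, sub_self, nabs_zero]
    positivity
  · intro δ' hδ'
    rw [sqrtVol, sqrtVol, sqrtSet_congr (le_of_lt hδ')]

lemma summable_sqrtVol (δ : F) : Summable fun n => sqrtVol n δ :=
  Summable.of_nonneg_of_le (fun n => sqrtVol_nonneg n δ) (fun n => sqrtVol_le n δ)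
    ((summable_half_pow F).mul_left 2)

variable (F) in
lemma tsum_sqrtVol_zero :
    ∑' n, sqrtVol n (0 : F) = (resCard F + 1) / (resCard F - 1) := by
  have hq := one_lt_resCard F
  have hq0 := resCard_pos F
  have h0 (n : ℕ) : sqrtVol n (0 : F) = ((resCard F : ℝ) ^ ((n + 1) / 2))⁻¹ :=
    sqrtVol_of_nabs_le (by rw [nabs_zero]; positivity)
  simp_rw [h0]
  have h1 := (summable_half_pow F).hasSum.tendsto_sum_nat.comp
    (show Filter.Tendsto (fun d : ℕ => 2 * d + 1) Filter.atTop Filter.atTop from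
      Filter.tendsto_atTop_mono (fun d => by simp only [id]; omega) Filter.tendsto_id)
  refine tendsto_nhds_unique h1 ?_
  have h2 : Filter.Tendsto (fun d : ℕ => ((resCard F : ℝ) ^ d)⁻¹) Filter.atTop (nhds 0) := by
    simpa using tendsto_pow_atTop_nhds_zero_of_lt_one (inv_nonneg.2 hq0.le)
      (inv_lt_one_of_one_lt₀ hq)
  have h3 := (h2.const_mul (2 / ((resCard F : ℝ) - 1))).const_sub
    (((resCard F : ℝ) + 1) / (resCard F - 1))
  simp only [mul_zero, sub_zero] at h3
  exact h3.congr fun d => (sum_half_pow d).symm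

lemma sum_sqrtVol {δ : F} {m N : ℕ} (hδ : nabs F δ = ((resCard F : ℝ) ^ m)⁻¹) (hN : N ≤ m + 1) :
    ∑ n ∈ Finset.range N, sqrtVol n δ =
      ∑ n ∈ Finset.range N, ((resCard F : ℝ) ^ ((n + 1) / 2))⁻¹ := by
  refine Finset.sum_congr rfl fun n hn => sqrtVol_of_nabs_le ?_
  rw [hδ, inv_pow_le_inv_pow_iff]
  have := Finset.mem_range.1 hn
  omega

/-- For a nonsquare `δ` of valuation `m`, the congruence has no solution modulo higher powers than
the `m`-th. -/
lemma tsum_sqrtVol_of_not_isSquare (hp : ringChar 𝓀[F] ≠ 2) {δ : F} (h : ¬ IsSquare δ) {m : ℕ}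
    (hδ : nabs F δ = ((resCard F : ℝ) ^ m)⁻¹) :
    ∑' n, sqrtVol n δ = ∑ n ∈ Finset.range (m + 1), ((resCard F : ℝ) ^ ((n + 1) / 2))⁻¹ := by
  rw [← sum_sqrtVol hδ le_rfl]
  refine tsum_eq_sum fun n hn => ?_
  rw [sqrtVol, sqrtSet_eq_empty hp h, measure_empty, ENNReal.toReal_zero]
  rw [hδ, inv_pow_lt_inv_pow_iff]
  have := Finset.mem_range.not.1 hn
  omega

/-- For a square the series has the same value as for `δ = 0`, independently of the valuation. -/
lemma tsum_sqrtVol_sq (hp : ringChar 𝓀[F] ≠ 2) {r : F} {d : ℕ}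
    (hr : nabs F r = ((resCard F : ℝ) ^ d)⁻¹) :
    ∑' n, sqrtVol n (r ^ 2) = (resCard F + 1) / (resCard F - 1) := by
  have hq := one_lt_resCard F
  have hq1 : (resCard F : ℝ) - 1 ≠ 0 := by linarith
  have hq0 := resCard_pos F
  have hδ : nabs F (r ^ 2) = ((resCard F : ℝ) ^ (2 * d))⁻¹ := by
    rw [nabs_pow, hr, inv_pow, ← pow_mul, mul_comm]
  rw [← (summable_sqrtVol (r ^ 2)).sum_add_tsum_nat_add (2 * d + 1), sum_sqrtVol hδ le_rfl,
    sum_half_pow]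
  have h1 (n : ℕ) : sqrtVol (n + (2 * d + 1)) (r ^ 2) =
      2 * ((resCard F : ℝ) ^ (d + 1))⁻¹ * ((resCard F : ℝ)⁻¹) ^ n := by
    rw [sqrtVol_sq hp hr (by omega), show n + (2 * d + 1) - d = d + 1 + n by omega, pow_add,
      mul_inv, inv_pow, mul_assoc]
  simp_rw [h1]
  rw [tsum_mul_left, tsum_geometric_of_lt_one (inv_nonneg.2 hq0.le) (inv_lt_one_of_one_lt₀ hq)]
  rw [pow_succ]
  field_simp
  ring

end SquareRoots

/-! ### Ramification of quadratic extensions -/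

section Ramification

variable {F : Type*} [Field F] [ValuativeRel F] [TopologicalSpace F]
  [IsNonarchimedeanLocalField F]

variable (F) in
lemma unif_mem_integer : unif F ∈ 𝒪[F] := by
  rw [mem_integer_iff, nabs_unif]
  exact inv_le_one_of_one_le₀ (one_lt_resCard F).le

variable (F) in
lemma maximalIdeal_eq_span : 𝓂[F] = Ideal.span {(⟨unif F, unif_mem_integer F⟩ : 𝒪[F])} := by
  ext x
  rw [mem_maximalIdeal_iff, Ideal.mem_span_singleton']
  have h := nabs_lt_zpow_iff (x := (x : F)) (n := 0)
  simp only [zpow_zero, zero_sub, zpow_neg_one] at h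
  rw [h]
  constructor
  · intro hx
    refine ⟨⟨(x : F) / unif F, ?_⟩, Subtype.ext (div_mul_cancel₀ _ unif_ne_zero)⟩
    rw [mem_integer_iff, nabs_div, div_le_one (nabs_pos unif_ne_zero), nabs_unif]
    exact hx
  · rintro ⟨y, rfl⟩
    have hy := mem_integer_iff.1 y.2
    have : ((y * ⟨unif F, unif_mem_integer F⟩ : 𝒪[F]) : F) = (y : F) * unif F := rfl
    rw [this, nabs_mul, nabs_unif]
    exact mul_le_of_le_one_left (inv_nonneg.2 (resCard_pos F).le) hy

variable {E : Type*} [Field E] [Algebra F E] [Algebra 𝒪[F] E] [IsScalarTower 𝒪[F] F E]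

lemma nabs_le_one_of_isIntegral {x : F} (hx : IsIntegral 𝒪[F] (algebraMap F E x)) :
    nabs F x ≤ 1 := by
  rw [isIntegral_algebraMap_iff (algebraMap F E).injective] at hx
  obtain ⟨y, rfl⟩ := IsIntegrallyClosed.isIntegral_iff.1 hx
  exact mem_integer_iff.1 y.2

lemma isIntegral_of_nabs_le_one {x : F} (hx : nabs F x ≤ 1) :
    IsIntegral 𝒪[F] (algebraMap F E x) := by
  have h : algebraMap F E x = algebraMap 𝒪[F] E ⟨x, mem_integer_iff.2 hx⟩ := by
    rw [IsScalarTower.algebraMap_apply 𝒪[F] F E]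
    rfl
  rw [h]
  exact isIntegral_algebraMap

lemma mem_map_maximalIdeal_iff {b : integralClosure 𝒪[F] E} :
    b ∈ Ideal.map (algebraMap 𝒪[F] (integralClosure 𝒪[F] E)) 𝓂[F] ↔
      IsIntegral 𝒪[F] ((b : E) / algebraMap F E (unif F)) := by
  have hϖ : algebraMap F E (unif F) ≠ 0 := by simpa using unif_ne_zero
  have hmap : ((algebraMap 𝒪[F] (integralClosure 𝒪[F] E) ⟨unif F, unif_mem_integer F⟩ :
      integralClosure 𝒪[F] E) : E) = algebraMap F E (unif F) :=
    IsScalarTower.algebraMap_apply 𝒪[F] F E _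
  rw [maximalIdeal_eq_span, Ideal.map_span, Set.image_singleton, Ideal.mem_span_singleton']
  constructor
  · rintro ⟨c, rfl⟩
    rw [MulMemClass.coe_mul, hmap, mul_div_cancel_right₀ _ hϖ]
    exact c.2
  · intro h
    refine ⟨⟨_, h⟩, Subtype.ext ?_⟩
    rw [MulMemClass.coe_mul, hmap, div_mul_cancel₀ _ hϖ]

/-- Adjoining the square root of an element of odd valuation gives a ramified extension: the
square of a suitable multiple `π` of the root is a uniformizer, so that `π` does not lie in the
ideal generated by the uniformizer although its square does. -/
lemma not_isMaximal_of_odd {δ : F} {r : E} (hr : r ^ 2 = algebraMap F E δ) {d : ℕ}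
    (hδ : nabs F δ = ((resCard F : ℝ) ^ (2 * d + 1))⁻¹) :
    ¬ (Ideal.map (algebraMap 𝒪[F] (integralClosure 𝒪[F] E)) 𝓂[F]).IsMaximal := by
  intro hmax
  have hq := one_lt_resCard F
  have hq0 := resCard_pos F
  have hε : nabs F (δ / unif F ^ (2 * d)) = (resCard F : ℝ)⁻¹ := by
    rw [nabs_div, hδ, nabs_unif_pow, pow_succ]
    field_simp
  set π : E := r / algebraMap F E (unif F ^ d) with hπ
  have hπ2 : π ^ 2 = algebraMap F E (δ / unif F ^ (2 * d)) := by
    rw [hπ, div_pow, hr, map_div₀, ← map_pow, ← pow_mul, mul_comm d 2]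
  have hπi : IsIntegral 𝒪[F] π := by
    refine IsIntegral.of_pow two_pos ?_
    rw [hπ2]
    exact isIntegral_of_nabs_le_one (hε ▸ inv_le_one_of_one_le₀ hq.le)
  set b : integralClosure 𝒪[F] E := ⟨π, hπi⟩ with hb
  have hb2 : b ^ 2 ∈ Ideal.map (algebraMap 𝒪[F] (integralClosure 𝒪[F] E)) 𝓂[F] := by
    rw [mem_map_maximalIdeal_iff]
    have : ((b ^ 2 : integralClosure 𝒪[F] E) : E) = π ^ 2 := rfl
    rw [this, hπ2, ← map_div₀]
    refine isIntegral_of_nabs_le_one ?_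
    rw [nabs_div, hε, nabs_unif, div_self (inv_ne_zero hq0.ne')]
  have hb1 := mem_map_maximalIdeal_iff.1 (hmax.isPrime.mem_of_pow_mem 2 hb2)
  have h2 := hb1.pow 2
  rw [div_pow, hb, hπ2, ← map_pow, ← map_div₀] at h2
  have h3 := nabs_le_one_of_isIntegral h2
  rw [nabs_div, hε, nabs_unif_pow, div_le_one (by positivity), ← pow_one (resCard F : ℝ),
    ← pow_mul, one_mul, inv_pow_le_inv_pow_iff] at h3
  omega

/-- Integrality in `F(√u)`, where `u` is a unit which is not a square. -/
lemma nabs_le_one_of_isIntegral_add (hp : ringChar 𝓀[F] ≠ 2) {u : F} {ρ : E}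
    (hρ : ρ ^ 2 = algebraMap F E u) (hu : ¬ IsSquare u) (hu1 : nabs F u = 1) {α β : F}
    (h : IsIntegral 𝒪[F] (algebraMap F E α + algebraMap F E β * ρ)) :
    nabs F α ≤ 1 ∧ nabs F β ≤ 1 := by
  by_cases hβ : β = 0
  · rw [hβ, map_zero, zero_mul, add_zero] at h
    exact ⟨nabs_le_one_of_isIntegral h, by simp [hβ]⟩
  set x := algebraMap F E α + algebraMap F E β * ρ with hx
  set P : Polynomial F := Polynomial.X ^ 2 + (Polynomial.C (-(2 * α)) * Polynomial.X +
    Polynomial.C (α ^ 2 - u * β ^ 2)) with hP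
  have hPm : P.Monic := Polynomial.monic_X_pow_add (by
    refine (Polynomial.degree_linear_le).trans_lt ?_
    norm_num)
  have hPd : P.natDegree = 2 := by
    rw [hP]
    compute_degree!
  have hPi : Irreducible P := by
    rw [hPm.irreducible_iff_roots_eq_zero_of_degree_le_three hPd.ge (by omega)]
    refine Multiset.eq_zero_of_forall_notMem fun t ht => hu ?_
    have h1 : t ^ 2 + (-(2 * α) * t + (α ^ 2 - u * β ^ 2)) = 0 := by
      simpa [hP] using (Polynomial.mem_roots'.1 ht).2
    refine ⟨(t - α) / β, ?_⟩
    field_simp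
    linear_combination -h1
  have hPx : Polynomial.aeval x P = 0 := by
    simp only [hP, map_add, map_mul, map_pow, Polynomial.aeval_X, Polynomial.aeval_C, map_neg,
      map_sub, map_ofNat]
    rw [hx]
    linear_combination (algebraMap F E β) ^ 2 * hρ
  have hmin : P = (minpoly 𝒪[F] x).map (algebraMap 𝒪[F] F) := by
    rw [← minpoly.isIntegrallyClosed_eq_field_fractions F E h]
    exact minpoly.eq_of_irreducible_of_monic hPi hPx hPm
  have hcoeff (n : ℕ) : nabs F (P.coeff n) ≤ 1 := by
    rw [hmin, Polynomial.coeff_map]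
    exact mem_integer_iff.1 ((minpoly 𝒪[F] x).coeff n).2
  have coeffs (b c : F) : (Polynomial.X ^ 2 + (Polynomial.C b * Polynomial.X +
      Polynomial.C c)).coeff 1 = b ∧ (Polynomial.X ^ 2 + (Polynomial.C b * Polynomial.X +
      Polynomial.C c)).coeff 0 = c := by
    simp [Polynomial.coeff_C]
  have h1 : P.coeff 1 = -(2 * α) := (coeffs _ _).1
  have h0 : P.coeff 0 = α ^ 2 - u * β ^ 2 := (coeffs _ _).2
  have hα : nabs F α ≤ 1 := by
    have := hcoeff 1
    rwa [h1, nabs_neg, nabs_mul, nabs_two F hp, one_mul] at this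
  refine ⟨hα, ?_⟩
  have h2 := hcoeff 0
  rw [h0] at h2
  have hα2 : nabs F (α ^ 2) ≤ 1 := by
    rw [nabs_pow]
    exact pow_le_one₀ (nabs_nonneg _) hα
  have h3 := (nabs_sub_le (α ^ 2) (α ^ 2 - u * β ^ 2)).trans (max_le hα2 h2)
  rw [sub_sub_cancel, nabs_mul, hu1, one_mul, nabs_pow] at h3
  exact (pow_le_one_iff_of_nonneg (nabs_nonneg _) two_ne_zero).1 h3

/-- Adjoining the square root of a nonsquare of even valuation gives an unramified extension: the
norm of an integral element outside the ideal generated by the uniformizer is a unit. -/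
lemma isMaximal_of_even (hp : ringChar 𝓀[F] ≠ 2) {δ : F} {r : E}
    (hr : r ^ 2 = algebraMap F E δ) (hgen : ∀ x : E, ∃ α β : F,
      x = algebraMap F E α + algebraMap F E β * r) (hsq : ¬ IsSquare δ) {d : ℕ}
    (hδ : nabs F δ = ((resCard F : ℝ) ^ (2 * d))⁻¹) :
    (Ideal.map (algebraMap 𝒪[F] (integralClosure 𝒪[F] E)) 𝓂[F]).IsMaximal := by
  have hq := one_lt_resCard F
  have hq0 := resCard_pos F
  have hϖd : unif F ^ d ≠ 0 := pow_ne_zero d unif_ne_zero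
  set u := δ / unif F ^ (2 * d) with hu
  have hu1 : nabs F u = 1 := by
    rw [nabs_div, hδ, nabs_unif_pow, div_self (by positivity)]
  have husq : ¬ IsSquare u := by
    rintro ⟨v, hv⟩
    refine hsq ⟨v * unif F ^ d, ?_⟩
    have : δ = u * unif F ^ (2 * d) := (div_mul_cancel₀ _ (pow_ne_zero _ unif_ne_zero)).symm
    rw [this, hv]
    ring
  set ρ : E := r / algebraMap F E (unif F ^ d) with hρ
  have hρ2 : ρ ^ 2 = algebraMap F E u := by
    rw [hρ, div_pow, hr, map_div₀, ← map_pow, ← pow_mul, mul_comm d 2]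
  have hϖE : algebraMap F E (unif F ^ d) ≠ 0 := by
    rwa [Ne, map_eq_zero]
  have hgen' (x : E) : ∃ α β : F, x = algebraMap F E α + algebraMap F E β * ρ := by
    obtain ⟨α, β, rfl⟩ := hgen x
    refine ⟨α, β * unif F ^ d, ?_⟩
    rw [hρ, map_mul]
    field_simp
  have hρi : IsIntegral 𝒪[F] ρ := by
    refine IsIntegral.of_pow two_pos ?_
    rw [hρ2]
    exact isIntegral_of_nabs_le_one hu1.le
  have hdisc {x : F} (hx : nabs F x < 1) : nabs F x ≤ (resCard F : ℝ)⁻¹ := by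
    have h := nabs_lt_zpow_iff (x := x) (n := 0)
    simp only [zpow_zero, zero_sub, zpow_neg_one] at h
    exact h.1 hx
  refine Ideal.isMaximal_iff.2 ⟨fun h1 => ?_, fun J x hIJ hxI hxJ => ?_⟩
  · have h2 := mem_map_maximalIdeal_iff.1 h1
    rw [OneMemClass.coe_one, ← map_one (algebraMap F E), ← map_div₀] at h2
    have h3 := nabs_le_one_of_isIntegral h2
    rw [nabs_div, nabs_one, nabs_unif, one_div, inv_inv] at h3
    linarith
  · obtain ⟨α, β, hx⟩ := hgen' x
    obtain ⟨hα, hβ⟩ := nabs_le_one_of_isIntegral_add hp hρ2 husq hu1 (hx ▸ x.2)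
    -- the norm of `x`
    set N := α ^ 2 - u * β ^ 2 with hN
    have hN1 : nabs F N = 1 := by
      rcases hβ.lt_or_eq with hβ1 | hβ1
      · rcases hα.lt_or_eq with hα1 | hα1
        · refine absurd (mem_map_maximalIdeal_iff.2 ?_) hxI
          have hdiv {y : F} (hy : nabs F y < 1) :
              IsIntegral 𝒪[F] (algebraMap F E y / algebraMap F E (unif F)) := by
            rw [← map_div₀]
            refine isIntegral_of_nabs_le_one ?_
            rw [nabs_div, div_le_one (nabs_pos unif_ne_zero), nabs_unif]
            exact hdisc hy
          have e : (x : E) / algebraMap F E (unif F) =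
              algebraMap F E α / algebraMap F E (unif F) +
                algebraMap F E β / algebraMap F E (unif F) * ρ := by
            rw [hx]
            ring
          rw [e]
          exact (hdiv hα1).add ((hdiv hβ1).mul hρi)
        · have h1 : nabs F (-(u * β ^ 2)) < nabs F (α ^ 2) := by
            rw [nabs_neg, nabs_mul, hu1, nabs_pow, nabs_pow, hα1, one_mul, one_pow]
            exact pow_lt_one₀ (nabs_nonneg _) hβ1 two_ne_zero
          rw [hN, sub_eq_add_neg, nabs_add_eq_left h1, nabs_pow, hα1, one_pow]
      · have hβ0 : β ≠ 0 := by
          rintro rfl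
          simp at hβ1
        have hle : nabs F N ≤ 1 := by
          refine (nabs_sub_le _ _).trans (max_le ?_ ?_)
          · rw [nabs_pow]
            exact pow_le_one₀ (nabs_nonneg _) hα
          · rw [nabs_mul, nabs_pow, hu1, hβ1]
            norm_num
        refine hle.lt_or_eq.resolve_left fun hlt => ?_
        -- otherwise `α / β` would be a square root of `u` modulo the maximal ideal
        have hempty := sqrtSet_eq_empty hp (n := 1) husq (by
          rw [hu1, pow_one]
          exact inv_lt_one_of_one_lt₀ hq)
        have hmem : α / β ∈ sqrtSet 1 u := by
          refine ⟨by rwa [nabs_div, hβ1, div_one], ?_⟩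
          have e : u - (α / β) ^ 2 = -(N / β ^ 2) := by
            rw [hN]
            field_simp
            ring
          rw [e, nabs_neg, nabs_div, nabs_pow, hβ1, one_pow, div_one, pow_one]
          exact hdisc hlt
        rw [hempty] at hmem
        exact hmem
    have hN0 : N ≠ 0 := by
      rw [Ne, ← nabs_eq_zero, hN1]
      exact one_ne_zero
    have hy : IsIntegral 𝒪[F] ((algebraMap F E α - algebraMap F E β * ρ) *
        algebraMap F E N⁻¹) :=
      ((isIntegral_of_nabs_le_one hα).sub ((isIntegral_of_nabs_le_one hβ).mul hρi)).mul
        (isIntegral_of_nabs_le_one (by rw [nabs_inv, hN1, inv_one]))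
    have hprod : (⟨_, hy⟩ : integralClosure 𝒪[F] E) * x = 1 := by
      refine Subtype.ext ?_
      rw [MulMemClass.coe_mul, OneMemClass.coe_one, hx]
      change (algebraMap F E α - algebraMap F E β * ρ) * algebraMap F E N⁻¹ *
        (algebraMap F E α + algebraMap F E β * ρ) = 1
      have hNE : algebraMap F E N = (algebraMap F E α) ^ 2 - algebraMap F E β ^ 2 * ρ ^ 2 := by
        rw [hρ2, hN, map_sub, map_mul, map_pow, map_pow]
        ring
      have hNE0 : algebraMap F E N ≠ 0 := by simpa using hN0
      rw [map_inv₀]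
      field_simp
      rw [hNE]
      ring
    rw [← hprod]
    exact J.mul_mem_left _ hxJ

end Ramification

/-! ### Hyperbolic, unramified and ramified elements -/

section Types

variable {F : Type*} [Field F]

/-- The roots of the characteristic polynomial of `g` are the elements `x` for which
`x - (tr g) / 2` is a square root of `(tr g) ^ 2 / 4 - det g`. -/
lemma charpoly_root_iff {E : Type*} [Field E] [Algebra F E] (h2 : (2 : F) ≠ 0) (g : GL (Fin 2) F)
    (x : E) : Polynomial.aeval x g.val.charpoly = 0 ↔
      (x - algebraMap F E (g.val.trace / 2)) ^ 2 =
        algebraMap F E (g.val.trace ^ 2 / 4 - g.val.det) := by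
  have h2E : (2 : E) ≠ 0 := by
    rw [← map_ofNat (algebraMap F E) 2]
    simpa using h2
  have h4 : (4 : E) = 2 * 2 := by norm_num
  have h4E : (4 : E) ≠ 0 := h4 ▸ mul_ne_zero h2E h2E
  rw [Matrix.charpoly_fin_two]
  simp only [map_add, map_sub, map_mul, map_pow, Polynomial.aeval_X, Polynomial.aeval_C, map_div₀,
    map_ofNat]
  rw [← sub_eq_zero (b := _ - algebraMap F E g.val.det)]
  refine Eq.congr_left ?_
  field_simp
  ring

lemma disc_div_four_ne_zero (h2 : (2 : F) ≠ 0) {a s : F} (hd : a ^ 2 - 4 * s ≠ 0) :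
    a ^ 2 / 4 - s ≠ 0 := by
  have h4 : (4 : F) = 2 * 2 := by norm_num
  have h4F : (4 : F) ≠ 0 := h4 ▸ mul_ne_zero h2 h2
  intro h
  apply hd
  field_simp at h
  linear_combination h

lemma isHyperbolic_iff (h2 : (2 : F) ≠ 0) (g : GL (Fin 2) F) :
    IsHyperbolic g ↔ IsSquare (g.val.trace ^ 2 / 4 - g.val.det) := by
  have hdeg : g.val.charpoly.natDegree = 2 := by
    rw [Matrix.charpoly_natDegree_eq_dim, Fintype.card_fin]
  constructor
  · intro h
    obtain ⟨x, hx⟩ := Polynomial.Splits.exists_eval_eq_zero h (by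
      rw [Polynomial.degree_eq_natDegree g.val.charpoly_monic.ne_zero, hdeg]
      norm_num)
    have := (charpoly_root_iff (E := F) h2 g x).1 (by simpa using hx)
    exact ⟨_, by rw [← pow_two]; exact this.symm⟩
  · rintro ⟨r, hr⟩
    have h4 : (4 : F) = 2 * 2 := by norm_num
    have h4F : (4 : F) ≠ 0 := h4 ▸ mul_ne_zero h2 h2
    have hs : g.val.det = g.val.trace ^ 2 / 4 - r * r := by rw [← hr]; ring
    have hfac : g.val.charpoly = (Polynomial.X - Polynomial.C (g.val.trace / 2 + r)) *
        (Polynomial.X - Polynomial.C (g.val.trace / 2 - r)) := by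
      have h1 : g.val.trace = (g.val.trace / 2 + r) + (g.val.trace / 2 - r) := by
        field_simp
        ring
      have h2 : g.val.det = (g.val.trace / 2 + r) * (g.val.trace / 2 - r) := by
        rw [hs]
        field_simp
        ring
      have key : ∀ u v : F, (Polynomial.X - Polynomial.C u) * (Polynomial.X - Polynomial.C v) =
          Polynomial.X ^ 2 - Polynomial.C (u + v) * Polynomial.X + Polynomial.C (u * v) := by
        intro u v
        rw [Polynomial.C_add, Polynomial.C_mul]
        ring
      rw [Matrix.charpoly_fin_two, key, ← h1, ← h2]
    rw [IsHyperbolic, hfac]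
    exact (Polynomial.Splits.X_sub_C _).mul (Polynomial.Splits.X_sub_C _)

/-- The splitting field of the characteristic polynomial is obtained by adjoining a square root of
`(tr g) ^ 2 / 4 - det g`. -/
lemma exists_sqrt_splittingField (h2 : (2 : F) ≠ 0) (g : GL (Fin 2) F) :
    ∃ r : g.val.charpoly.SplittingField,
      r ^ 2 = algebraMap F _ (g.val.trace ^ 2 / 4 - g.val.det) ∧
      ∀ x, ∃ α β : F, x = algebraMap F _ α + algebraMap F _ β * r := by
  set E := g.val.charpoly.SplittingField
  have hdeg : g.val.charpoly.natDegree = 2 := by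
    rw [Matrix.charpoly_natDegree_eq_dim, Fintype.card_fin]
  have hmon := g.val.charpoly_monic
  obtain ⟨x, hx⟩ := Polynomial.Splits.exists_eval_eq_zero
    (Polynomial.SplittingField.splits g.val.charpoly) (by
      rw [Polynomial.degree_map, Polynomial.degree_eq_natDegree hmon.ne_zero, hdeg]
      norm_num)
  rw [Polynomial.eval_map_algebraMap] at hx
  set r : E := x - algebraMap F E (g.val.trace / 2) with hr
  have hr2 := (charpoly_root_iff h2 g x).1 hx
  refine ⟨r, hr2, fun y => ?_⟩
  have hy : y ∈ Algebra.adjoin F (g.val.charpoly.rootSet E) := by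
    rw [Polynomial.SplittingField.adjoin_rootSet]
    trivial
  induction hy using Algebra.adjoin_induction with
  | mem z hz =>
    have hz2 := (charpoly_root_iff h2 g z).1 (Polynomial.mem_rootSet.1 hz).2
    rw [← hr2, sq_eq_sq_iff_eq_or_eq_neg] at hz2
    rcases hz2 with h | h
    · exact ⟨g.val.trace / 2, 1, by rw [map_one, one_mul, hr, ← h]; ring⟩
    · refine ⟨g.val.trace / 2, -1, ?_⟩
      rw [map_neg, map_one, hr, neg_one_mul, ← h]
      ring
  | algebraMap z => exact ⟨z, 0, by simp⟩
  | add z w _ _ hz hw =>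
    obtain ⟨α, β, rfl⟩ := hz
    obtain ⟨α', β', rfl⟩ := hw
    exact ⟨α + α', β + β', by rw [map_add, map_add]; ring⟩
  | mul z w _ _ hz hw =>
    obtain ⟨α, β, rfl⟩ := hz
    obtain ⟨α', β', rfl⟩ := hw
    refine ⟨α * α' + β * β' * (g.val.trace ^ 2 / 4 - g.val.det), α * β' + α' * β, ?_⟩
    rw [map_add, map_mul (algebraMap F _) (β * β'), ← hr2, map_add]
    simp only [map_mul]
    ring

variable [ValuativeRel F] [TopologicalSpace F] [IsNonarchimedeanLocalField F]

lemma isUnramified_of_even (hp : ringChar 𝓀[F] ≠ 2) {g : GL (Fin 2) F} (hg : IsElliptic g) {d : ℕ}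
    (hd : nabs F (g.val.trace ^ 2 / 4 - g.val.det) = ((resCard F : ℝ) ^ (2 * d))⁻¹) :
    IsUnramified g := by
  have h2 := two_ne_zero_of_ringChar hp
  obtain ⟨r, hr, hgen⟩ := exists_sqrt_splittingField h2 g
  exact isMaximal_of_even hp hr hgen ((isHyperbolic_iff h2 g).not.1 hg) hd

lemma not_isUnramified_of_odd (hp : ringChar 𝓀[F] ≠ 2) {g : GL (Fin 2) F} {d : ℕ}
    (hd : nabs F (g.val.trace ^ 2 / 4 - g.val.det) = ((resCard F : ℝ) ^ (2 * d + 1))⁻¹) :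
    ¬ IsUnramified g := by
  obtain ⟨r, hr, -⟩ := exists_sqrt_splittingField (two_ne_zero_of_ringChar hp) g
  exact not_isMaximal_of_odd hr hd

lemma nabs_weylDisc (hp : ringChar 𝓀[F] ≠ 2) {g : GL (Fin 2) F} (hs : nabs F g.val.det = 1) :
    nabs F (weylDisc g) = nabs F (g.val.trace ^ 2 / 4 - g.val.det) := by
  have h2 := two_ne_zero_of_ringChar hp
  have h4 : (4 : F) = 2 * 2 := by norm_num
  have h4F : (4 : F) ≠ 0 := h4 ▸ mul_ne_zero h2 h2
  have e : g.val.trace ^ 2 - 4 * g.val.det = 2 * (2 * (g.val.trace ^ 2 / 4 - g.val.det)) := by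
    field_simp
    ring
  rw [weylDisc, nabs_div, nabs_neg, hs, div_one, e, nabs_mul, nabs_mul, nabs_two F hp, one_mul,
    one_mul]

/-- If the conjugacy class of `g` meets `GL₂(𝒪)`, then the trace of `g` is integral and its
determinant is a unit. -/
lemma integral_of_meets_maxCompact {g : GL (Fin 2) F}
    (h : (conjugatesOf g ∩ (maxCompact F : Set (GL (Fin 2) F))).Nonempty)
    (hd : g.val.trace ^ 2 - 4 * g.val.det ≠ 0) :
    nabs F g.val.trace ≤ 1 ∧ nabs F g.val.det = 1 := by
  obtain ⟨b, hb, hbK⟩ := h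
  rw [conjugatesOf_eq_fibre hd] at hb
  have h1 : b.val.trace = g.val.trace := congrArg Prod.fst hb
  have h2 : b.val.det = g.val.det := congrArg Prod.snd hb
  obtain ⟨h3, h4⟩ := mem_maxCompact_iff.1 hbK
  rw [← h1, ← h2, Matrix.trace_fin_two]
  exact ⟨(nabs_add_le _ _).trans (max_le (h3 0 0) (h3 1 1)), h4⟩

lemma nabs_disc_le_one (hp : ringChar 𝓀[F] ≠ 2) {a s : F} (ha : nabs F a ≤ 1)
    (hs : nabs F s ≤ 1) : nabs F (a ^ 2 / 4 - s) ≤ 1 := by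
  have h4 : (4 : F) = 2 * 2 := by norm_num
  refine (nabs_sub_le _ _).trans (max_le ?_ hs)
  rw [nabs_div, h4, nabs_mul, nabs_two F hp, nabs_pow, mul_one, div_one]
  exact pow_le_one₀ (nabs_nonneg _) ha

/-! ### The values of the orbital integral -/

variable (F) in
/-- The common factor of the orbital integrals. -/
lemma volume_factor : (1 - 1 / (resCard F : ℝ) ^ 2)⁻¹ * ((resCard F + 1) / (resCard F - 1)) =
    (1 - 1 / (resCard F : ℝ)) ^ (-2 : ℤ) := by
  have hq := one_lt_resCard F
  have hq1 : (resCard F : ℝ) - 1 ≠ 0 := by linarith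
  have hq2 : (resCard F : ℝ) + 1 ≠ 0 := by linarith
  have hq0 := resCard_pos F
  have h1 : 1 - 1 / (resCard F : ℝ) ^ 2 =
      (resCard F - 1) * (resCard F + 1) / (resCard F : ℝ) ^ 2 := by
    field_simp
    ring
  have h2 : 1 - 1 / (resCard F : ℝ) = (resCard F - 1) / (resCard F : ℝ) := by
    field_simp
  rw [h1, h2, zpow_neg, zpow_ofNat]
  field_simp

variable [MeasurableSpace F] [BorelSpace F]

lemma orbitalIntegral_hyperbolic (hp : ringChar 𝓀[F] ≠ 2) {g : GL (Fin 2) F}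
    (hd : g.val.trace ^ 2 - 4 * g.val.det ≠ 0) (ha : nabs F g.val.trace ≤ 1)
    (hs : nabs F g.val.det = 1) (hg : IsHyperbolic g) :
    orbitalIntegral g (f₀ F) = (1 - 1 / (resCard F : ℝ)) ^ (-2 : ℤ) := by
  have h2 := two_ne_zero_of_ringChar hp
  obtain ⟨r, hr⟩ := (isHyperbolic_iff h2 g).1 hg
  rw [← pow_two] at hr
  have hr0 : r ≠ 0 := by
    rintro rfl
    exact disc_div_four_ne_zero h2 hd (by simpa using hr)
  have hr1 : nabs F r ≤ 1 := by
    have := nabs_disc_le_one hp ha hs.le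
    rw [hr, nabs_pow] at this
    exact (pow_le_one_iff_of_nonneg (nabs_nonneg _) two_ne_zero).1 this
  obtain ⟨d, hdr⟩ := nabs_eq_inv_pow hr0 hr1
  rw [orbitalIntegral_eq_tsum hp hd ha hs, hr, tsum_sqrtVol_sq hp hdr, volume_factor]

lemma orbitalIntegral_unramified (hp : ringChar 𝓀[F] ≠ 2) {g : GL (Fin 2) F}
    (hd : g.val.trace ^ 2 - 4 * g.val.det ≠ 0) (ha : nabs F g.val.trace ≤ 1)
    (hs : nabs F g.val.det = 1) (hg : IsElliptic g) {d : ℕ}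
    (hδ : nabs F (g.val.trace ^ 2 / 4 - g.val.det) = ((resCard F : ℝ) ^ (2 * d))⁻¹) :
    orbitalIntegral g (f₀ F) = (1 - 1 / (resCard F : ℝ)) ^ (-2 : ℤ) *
      (1 - 2 / ((resCard F : ℝ) + 1) * (resCard F : ℝ) ^ (-(d : ℤ))) := by
  have hsq := (isHyperbolic_iff (two_ne_zero_of_ringChar hp) g).not.1 hg
  have hq := one_lt_resCard F
  have hq1 : (resCard F : ℝ) - 1 ≠ 0 := by linarith
  have hq2 : (resCard F : ℝ) + 1 ≠ 0 := by linarith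
  have hq0 := resCard_pos F
  rw [orbitalIntegral_eq_tsum hp hd ha hs, tsum_sqrtVol_of_not_isSquare hp hsq hδ, sum_half_pow,
    ← volume_factor, mul_assoc, zpow_neg, zpow_natCast]
  congr 1
  field_simp

lemma orbitalIntegral_ramified (hp : ringChar 𝓀[F] ≠ 2) {g : GL (Fin 2) F}
    (hd : g.val.trace ^ 2 - 4 * g.val.det ≠ 0) (ha : nabs F g.val.trace ≤ 1)
    (hs : nabs F g.val.det = 1) (hg : IsElliptic g) {d : ℕ}
    (hδ : nabs F (g.val.trace ^ 2 / 4 - g.val.det) = ((resCard F : ℝ) ^ (2 * d + 1))⁻¹) :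
    orbitalIntegral g (f₀ F) = (1 - 1 / (resCard F : ℝ)) ^ (-2 : ℤ) *
      (1 - (resCard F : ℝ) ^ (-((d : ℤ) + 1))) := by
  have hsq := (isHyperbolic_iff (two_ne_zero_of_ringChar hp) g).not.1 hg
  have hq := one_lt_resCard F
  have hq1 : (resCard F : ℝ) - 1 ≠ 0 := by linarith
  have hq2 : (resCard F : ℝ) + 1 ≠ 0 := by linarith
  have hq0 := resCard_pos F
  have e : (resCard F : ℝ) ^ (-((d : ℤ) + 1)) = ((resCard F : ℝ) ^ d * resCard F)⁻¹ := by
    rw [zpow_neg, zpow_add_one₀ hq0.ne', zpow_natCast]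
  rw [orbitalIntegral_eq_tsum hp hd ha hs, tsum_sqrtVol_of_not_isSquare hp hsq hδ,
    Finset.sum_range_succ, sum_half_pow, show (2 * d + 1 + 1) / 2 = d + 1 by omega,
    ← volume_factor, mul_assoc, e, pow_succ]
  congr 1
  field_simp
  ring

/-! ### Continuity on the base of `SL₂` -/

open Classical in
variable (F) in
/-- The orbital integral of `f₀` as a function of the trace on `SL₂`. It vanishes off the ring of
integers. At the singular points `±2` the value is the one given by the series. -/
def slOrbitalFunction (a : F) : ℝ :=
  if nabs F a ≤ 1 then (1 - 1 / (resCard F : ℝ) ^ 2)⁻¹ * ∑' n : ℕ, sqrtVol n (a ^ 2 / 4 - 1)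
  else 0

variable (F) in
/-- The terms of the series are locally constant, and they are bounded independently of the
trace. -/
lemma continuous_slOrbitalFunction : Continuous (slOrbitalFunction F) := by
  have h1 : Continuous fun a : F => ∑' n : ℕ, sqrtVol n (a ^ 2 / 4 - 1) := by
    refine continuous_tsum (fun n => (continuous_sqrtVol n).comp (by fun_prop))
      ((summable_half_pow F).mul_left 2) fun n a => ?_
    rw [Real.norm_of_nonneg (sqrtVol_nonneg _ _)]
    exact sqrtVol_le _ _
  have hclopen : IsClopen {a : F | nabs F a ≤ 1} := by
    refine ⟨by simpa using isClosed_nabs_sub_le (0 : F) 1, ?_⟩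
    convert! isOpen_nabs_sub_lt (0 : F) (resCard F : ℝ) using 1
    ext a
    have := nabs_lt_zpow_iff (x := a) (n := 1)
    simp only [zpow_one, sub_self, zpow_zero] at this
    simp [this]
  refine Continuous.if (fun a ha => ?_) (continuous_const.mul h1) continuous_const
  rw [hclopen.frontier_eq] at ha
  exact absurd ha (Set.notMem_empty a)

lemma slOrbitalFunction_of_sq_eq_four (hp : ringChar 𝓀[F] ≠ 2) {a : F} (ha : nabs F a ≤ 1)
    (ha2 : a ^ 2 = 4) : slOrbitalFunction F a = (1 - 1 / (resCard F : ℝ)) ^ (-2 : ℤ) := by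
  have h2 := two_ne_zero_of_ringChar hp
  have h4 : (4 : F) = 2 * 2 := by norm_num
  have h4F : (4 : F) ≠ 0 := h4 ▸ mul_ne_zero h2 h2
  rw [slOrbitalFunction, if_pos ha, ha2, div_self h4F, sub_self, tsum_sqrtVol_zero, volume_factor]

end Types

end GeomOrbital

end

theorem mainTheorem4 {F : Type*} [Field F] [ValuativeRel F] [TopologicalSpace F]
    [IsNonarchimedeanLocalField F] [MeasurableSpace F] [BorelSpace F]
    (hp : ringChar 𝓀[F] ≠ 2) :
    -- the geometric measure is well defined
    (∀ γ : GL (Fin 2) F, GeomOrbital.IsRegularSemisimple γ →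
      ∃! μ : MeasureTheory.Measure (GL (Fin 2) F),
        GeomOrbital.IsGeometricMeasure (GeomOrbital.steinberg γ) μ) ∧
    -- the values of the orbital integral of `f₀`
    (∀ γ : GL (Fin 2) F, GeomOrbital.IsRegularSemisimple γ →
      (conjugatesOf γ ∩ (GeomOrbital.maxCompact F : Set (GL (Fin 2) F))).Nonempty →
      (GeomOrbital.IsHyperbolic γ →
        GeomOrbital.orbitalIntegral γ (GeomOrbital.f₀ F) =
          (1 - 1 / (GeomOrbital.resCard F : ℝ)) ^ (-2 : ℤ)) ∧
      (GeomOrbital.IsElliptic γ → GeomOrbital.IsUnramified γ →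
        ∃ d : ℕ,
          GeomOrbital.nabs F (GeomOrbital.weylDisc γ) =
            (GeomOrbital.resCard F : ℝ) ^ (-2 * (d : ℤ)) ∧
          GeomOrbital.orbitalIntegral γ (GeomOrbital.f₀ F) =
            (1 - 1 / (GeomOrbital.resCard F : ℝ)) ^ (-2 : ℤ) *
              (1 - 2 / ((GeomOrbital.resCard F : ℝ) + 1) *
                (GeomOrbital.resCard F : ℝ) ^ (-(d : ℤ)))) ∧
      (GeomOrbital.IsElliptic γ → ¬ GeomOrbital.IsUnramified γ →
        ∃ d : ℕ,
          GeomOrbital.nabs F (GeomOrbital.weylDisc γ) =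
            (GeomOrbital.resCard F : ℝ) ^ (-2 * (d : ℤ) - 1) ∧
          GeomOrbital.orbitalIntegral γ (GeomOrbital.f₀ F) =
            (1 - 1 / (GeomOrbital.resCard F : ℝ)) ^ (-2 : ℤ) *
              (1 - (GeomOrbital.resCard F : ℝ) ^ (-((d : ℤ) + 1))))) ∧
    -- continuity on the base of `SL₂`, in particular at the two singular points `2` and `-2`
    (∃ Φ : F → ℝ, Continuous Φ ∧
      Φ 2 = (1 - 1 / (GeomOrbital.resCard F : ℝ)) ^ (-2 : ℤ) ∧
      Φ (-2) = (1 - 1 / (GeomOrbital.resCard F : ℝ)) ^ (-2 : ℤ) ∧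
      ∀ γ : GL (Fin 2) F, GeomOrbital.IsRegularSemisimple γ → γ.val.det = 1 →
        GeomOrbital.orbitalIntegral γ (GeomOrbital.f₀ F) = Φ γ.val.trace) := by
  open GeomOrbital in
  have h2 := two_ne_zero_of_ringChar hp
  have hq0 := resCard_pos F
  refine ⟨fun γ hγ => ?_, fun γ hγ hK => ?_, slOrbitalFunction F, continuous_slOrbitalFunction F,
    ?_, ?_, fun γ hγ hdet => ?_⟩
  · exact existsUnique_isGeometricMeasure hp (steinberg_ne_zero γ)
      (disc_ne_zero_of_isRegularSemisimple h2 hγ)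
  · have hd := disc_ne_zero_of_isRegularSemisimple h2 hγ
    obtain ⟨ha, hs⟩ := integral_of_meets_maxCompact hK hd
    obtain ⟨m, hm⟩ := nabs_eq_inv_pow (disc_div_four_ne_zero h2 hd) (nabs_disc_le_one hp ha hs.le)
    refine ⟨orbitalIntegral_hyperbolic hp hd ha hs, fun hell hunr => ?_, fun hell hram => ?_⟩
    · rcases Nat.even_or_odd' m with ⟨d, rfl | rfl⟩
      · refine ⟨d, ?_, orbitalIntegral_unramified hp hd ha hs hell hm⟩
        rw [nabs_weylDisc hp hs, hm, neg_mul, zpow_neg]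
        norm_cast
      · exact absurd hunr (not_isUnramified_of_odd hp hm)
    · rcases Nat.even_or_odd' m with ⟨d, rfl | rfl⟩
      · exact absurd (isUnramified_of_even hp hell hm) hram
      · refine ⟨d, ?_, orbitalIntegral_ramified hp hd ha hs hell hm⟩
        rw [nabs_weylDisc hp hs, hm, show -2 * (d : ℤ) - 1 = -((2 * d + 1 : ℕ) : ℤ) by
          push_cast; ring, zpow_neg, zpow_natCast]
  · exact slOrbitalFunction_of_sq_eq_four hp (nabs_two F hp).le (by norm_num)
  · exact slOrbitalFunction_of_sq_eq_four hp (by rw [nabs_neg, nabs_two F hp]) (by norm_num)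
  · have hd := disc_ne_zero_of_isRegularSemisimple h2 hγ
    rw [slOrbitalFunction]
    split_ifs with ha
    · rw [orbitalIntegral_eq_tsum hp hd ha (by rw [hdet, nabs_one]), hdet]
    · exact orbitalIntegral_eq_zero hd ha
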